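/- Let $\pi:Y\to X$ be a fibration (smooth surjective submersion) with $\dim X=n\ge 1$ and $\dim Y=n+m$. On the jet prolongations $J^kY$ use the induced fibered coordinates $(x^i,y^\sigma_I)$, the contact forms $\omega^\sigma_I=dy^\sigma_I-y^\sigma_{Ij}dx^j$, the decomposition of (the pull-back to $J^{k+1}Y$ of) a $q$-form into its $i$-contact components $p_i$, $0\le i\le q$, the horizontalization $h=p_0$, the horizontal differential $d_H\alpha=\sum_{l=0}^{q}p_l\,d\,p_l\alpha$ of a $q$-form $\alpha$, and the formal derivatives $d_I$ (Lie derivatives of forms along the total derivatives). For an $(n+1)$-form $\eta$ of order $s$ let $$\mathcal I(\eta)=\omega^\sigma\wedge\sum_{|I|\le s}(-1)^{|I|}d_I\Big(\frac{\partial}{\partial y^\sigma_I}\rfloor p_1\eta\Big)$$ be the interior Euler operator; a (local) residual form of $\eta$ is a smooth $n$-form $\mathcal R(\eta)$ on some jet prolongation with $p_0\mathcal R(\eta)=0$ and $p_1\eta=\mathcal I(\eta)+p_1\,d\,p_1\mathcal R(\eta)$ up to pull-backs. For a vertical vector field $\psi$ on $Y$ and a Lagrangian $\lambda$ (a horizontal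 $n$-form), the Noether current is $\epsilon_\psi(\lambda)=J\psi\rfloor\big(-p_1\mathcal R(d\lambda)\big)$, where $J\psi$ is the jet prolongation of $\psi$; it depends on the choice of $\mathcal R(d\lambda)$. Contractions of forms on jet prolongations with $\psi$ are contractions with its prolongation. Let $\rho$ be a smooth $n$-form on $J^rY$, with associated Lagrangian $h\rho$, and let $\psi_1,\psi_2$ be smooth vertical vector fields on $Y$. Then on every fibered coordinate domain a residual form $\mathcal R\big(d(\psi_1\rfloor\mathcal I d(h\rho))\big)$ exists, and for every choice of it, up to pull-backs by the jet projections, $$\psi_1\rfloor\mathcal I d\big(\psi_2\rfloor\mathcal I d(h\rho)\big)-\psi_2\rfloor\mathcal I d\big(\psi_1\rfloor\mathcal I d(h\rho)\big)=[\psi_1,\psi_2]\rfloor\mathcal I d(h\rho)+d_H\Big(\epsilon_{\psi_2}\big(\psi_1\rfloor\mathcal I d(h\rho)\big)\Big).$$ -/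

import Mathlib

open scoped Manifold ContDiff

attribute [-instance] TopCat.of.chartedSpace

noncomputable section

namespace FiberedJet

/-! ### Multi-indices -/

/-- Multi-indices over `n` base coordinates of length at most `k`, up to rearrangement:
`I i` is the number of times that the index `i` occurs. -/
abbrev MultiIndex (n k : ℕ) : Type := {I : Fin n → ℕ // ∑ i, I i ≤ k}

instance finiteMultiIndex (n k : ℕ) : Finite (MultiIndex n k) := by
  refine Set.Finite.to_subtype (Set.Finite.subset (Set.finite_Iic (fun _ : Fin n => k)) ?_)
  intro I hI i
  exact (Finset.single_le_sum (f := I) (fun _ _ => Nat.zero_le _) (Finset.mem_univ i)).trans hI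

instance fintypeMultiIndex (n k : ℕ) : Fintype (MultiIndex n k) := Fintype.ofFinite _

/-- The empty multi-index. -/
def MultiIndex.zero (n k : ℕ) : MultiIndex n k := ⟨0, by simp⟩

/-- The multi-index `I i`, one longer than `I`. -/
def MultiIndex.snoc {n k : ℕ} (I : MultiIndex n k) (i : Fin n) : MultiIndex n (k + 1) :=
  ⟨I.1 + Pi.single i 1, by simpa [Finset.sum_add_distrib] using I.2⟩

/-- `I`, seen among the multi-indices of length at most `k + 1`. -/
def MultiIndex.lift {n k : ℕ} (I : MultiIndex n k) : MultiIndex n (k + 1) :=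
  ⟨I.1, I.2.trans (Nat.le_succ k)⟩

/-- The length of a multi-index. -/
def MultiIndex.len {n k : ℕ} (I : MultiIndex n k) : ℕ := ∑ i, I.1 i

/-- The tuple (in increasing order) that represents a multi-index. -/
def MultiIndex.tuple {n k : ℕ} (I : MultiIndex n k) : List (Fin n) :=
  (List.finRange n).flatMap fun i => List.replicate (I.1 i) i

/-! ### Coordinates on jet prolongations and differential forms in these coordinates -/

/-- The range of fibered coordinates `(x^i, y^σ)`. -/
abbrev FibCoord (n m : ℕ) : Type := (Fin n → ℝ) × (Fin m → ℝ)

/-- The range of the induced coordinates `(x^i, y^σ_I)`, `|I| ≤ k`, on the `k`-th jet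
prolongation. -/
abbrev JetCoord (n m k : ℕ) : Type := (Fin n → ℝ) × (MultiIndex n k → Fin m → ℝ)

/-- Differential `q`-forms in the induced coordinates on the `k`-th jet prolongation. -/
abbrev LocForm (n m k q : ℕ) : Type := JetCoord n m k → (JetCoord n m k) [⋀^Fin q]→L[ℝ] ℝ

/-- The projection from `k`-jets to the underlying point. -/
def toFib {n m k : ℕ} (u : JetCoord n m k) : FibCoord n m := (u.1, u.2 (MultiIndex.zero n k))

/-- The projection `π_{k,l}` from `k`-jets to `l`-jets (only used for `l ≤ k`; for `l > k` the
missing coordinates are set to `0`). -/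
def jetProj (n m k l : ℕ) : JetCoord n m k →L[ℝ] JetCoord n m l :=
  (ContinuousLinearMap.fst ℝ _ _).prod
    (ContinuousLinearMap.pi fun I : MultiIndex n l =>
      if h : ∑ i, I.1 i ≤ k then
        (ContinuousLinearMap.proj (R := ℝ) (φ := fun _ : MultiIndex n k => Fin m → ℝ)
          ⟨I.1, h⟩).comp (ContinuousLinearMap.snd ℝ _ _)
      else 0)

/-- Pull-back of forms by the projection `π_{l,k}`, `k ≤ l`. -/
def pull {n m k q : ℕ} (l : ℕ) (ρ : LocForm n m k q) : LocForm n m l q := fun u =>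
  (ρ (jetProj n m l k u)).compContinuousLinearMap (jetProj n m l k)

/-- The linear map `(x^i, y^σ_I) ↦ (0, y^σ_{Ii})`. -/
def shift {n m k : ℕ} (i : Fin n) : JetCoord n m (k + 1) →L[ℝ] JetCoord n m k :=
  (0 : JetCoord n m (k + 1) →L[ℝ] (Fin n → ℝ)).prod
    (ContinuousLinearMap.pi fun I : MultiIndex n k =>
      (ContinuousLinearMap.proj (R := ℝ) (φ := fun _ : MultiIndex n (k + 1) => Fin m → ℝ)
        (I.snoc i)).comp (ContinuousLinearMap.snd ℝ _ _))

/-- The formal derivative `d_i = ∂/∂x^i + ∑ y^σ_{Ii} ∂/∂y^σ_I`, `|I| ≤ k`, as a vector field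
along `π_{k+1,k}`. -/
def totalVec {n m k : ℕ} (i : Fin n) (u : JetCoord n m (k + 1)) : JetCoord n m k :=
  (Pi.single i 1, fun I => u.2 (I.snoc i))

/-- The horizontal component `∑ dx^i(v) d_i` of (the projection of) a tangent vector `v` at
the `(k+1)`-jet `u`. -/
def hor {n m k : ℕ} (u : JetCoord n m (k + 1)) : JetCoord n m (k + 1) →L[ℝ] JetCoord n m k :=
  ∑ i, ((ContinuousLinearMap.proj (R := ℝ) (φ := fun _ : Fin n => ℝ) i).comp
    (ContinuousLinearMap.fst ℝ _ _)).smulRight (totalVec i u)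

/-- The complementary component `∑ ω^σ_I(v) ∂/∂y^σ_I`, `|I| ≤ k`, of a tangent vector `v` at
the `(k+1)`-jet `u`. -/
def con {n m k : ℕ} (u : JetCoord n m (k + 1)) : JetCoord n m (k + 1) →L[ℝ] JetCoord n m k :=
  jetProj n m (k + 1) k - hor u

/-- The contact form `ω^σ_I = dy^σ_I - y^σ_{Ij} dx^j` at the `(k+1)`-jet `u`, `|I| ≤ k`. -/
def contactForm {n m k : ℕ} (I : MultiIndex n k) (σ : Fin m) (u : JetCoord n m (k + 1)) :
    JetCoord n m (k + 1) →L[ℝ] ℝ :=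
  (ContinuousLinearMap.proj (R := ℝ) (φ := fun _ : Fin m => ℝ) σ).comp
    ((ContinuousLinearMap.proj (R := ℝ) (φ := fun _ : MultiIndex n k => Fin m → ℝ) I).comp
      ((ContinuousLinearMap.snd ℝ _ _).comp (con u)))

/-- The sum that defines contact components vanishes if two arguments coincide. -/
theorem sum_powersetCard_eq_zero {E F : Type*} [NormedAddCommGroup E] [NormedSpace ℝ E]
    [NormedAddCommGroup F] [NormedSpace ℝ F] {q : ℕ} (A : F [⋀^Fin q]→L[ℝ] ℝ)
    (C H : E →L[ℝ] F) (p : ℕ) (v : Fin q → E) {a b : Fin q} (hv : v a = v b) (hab : a ≠ b) :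
    (∑ S ∈ Finset.powersetCard p (Finset.univ : Finset (Fin q)),
      A.toContinuousMultilinearMap.compContinuousLinearMap
        (fun j => if j ∈ S then C else H)) v = 0 := by
  have key : ∀ S : Finset (Fin q),
      A (fun j => (if j ∈ S.map (Equiv.swap a b).toEmbedding then C else H) (v j)) =
        - A (fun j => (if j ∈ S then C else H) (v j)) := by
    intro S
    refine Eq.trans ?_ (A.toAlternatingMap.map_swap (fun j => (if j ∈ S then C else H) (v j)) hab)
    change A _ = A _
    congr 1
    funext j
    have h1 : j ∈ S.map (Equiv.swap a b).toEmbedding ↔ Equiv.swap a b j ∈ S := by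
      rw [Finset.mem_map_equiv, Equiv.symm_swap]
    have h2 : v (Equiv.swap a b j) = v j := by
      rcases eq_or_ne j a with rfl | ha
      · rw [Equiv.swap_apply_left, hv]
      · rcases eq_or_ne j b with rfl | hb
        · rw [Equiv.swap_apply_right, hv]
        · rw [Equiv.swap_apply_of_ne_of_ne ha hb]
    simp only [Function.comp_apply, h1, h2]
  set f : Finset (Fin q) → ℝ := fun S => A (fun j => (if j ∈ S then C else H) (v j)) with hf
  have hsum : ∑ S ∈ Finset.powersetCard p (Finset.univ : Finset (Fin q)), f S =
      ∑ S ∈ Finset.powersetCard p (Finset.univ : Finset (Fin q)), - f S := by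
    refine Finset.sum_bij' (fun S _ => S.map (Equiv.swap a b).toEmbedding)
      (fun S _ => S.map (Equiv.swap a b).toEmbedding) ?_ ?_ ?_ ?_ ?_
    · intro S hS
      simpa [Finset.mem_powersetCard] using hS
    · intro S hS
      simpa [Finset.mem_powersetCard] using hS
    · intro S _
      ext j; simp [Finset.mem_map_equiv]
    · intro S _
      ext j; simp [Finset.mem_map_equiv]
    · intro S _
      rw [hf]
      simp only [key S, neg_neg]
  rw [Finset.sum_neg_distrib] at hsum
  have h0 : ∑ S ∈ Finset.powersetCard p (Finset.univ : Finset (Fin q)), f S = 0 := by linarith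
  simpa [hf] using h0

/-- The `p`-contact component `p_p ρ` of a `q`-form `ρ` on `k`-jets: the sum of all terms in
which exactly `p` arguments enter through their contact component and the others through their
horizontal component. -/
def contactPart {n m k q : ℕ} (p : ℕ) (ρ : LocForm n m k q) : LocForm n m (k + 1) q := fun u =>
  { (∑ S ∈ Finset.powersetCard p (Finset.univ : Finset (Fin q)),
      (ρ (jetProj n m (k + 1) k u)).toContinuousMultilinearMap.compContinuousLinearMap
        (fun j => if j ∈ S then con u else hor u)) with
    map_eq_zero_of_eq' := by
      intro v a b hv hab
      exact sum_powersetCard_eq_zero (ρ (jetProj n m (k + 1) k u)) (con u) (hor u) p v hv hab }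

/-- The horizontalization `h = p_0`. -/
def horizontalize {n m k q : ℕ} (ρ : LocForm n m k q) : LocForm n m (k + 1) q := contactPart 0 ρ

/-- The horizontal differential `d_H ρ = ∑_{l=0}^q p_l d p_l ρ`. -/
def dH {n m k q : ℕ} (ρ : LocForm n m k q) : LocForm n m (k + 2) (q + 1) := fun u =>
  ∑ l ∈ Finset.range (q + 1), contactPart l (extDeriv (contactPart l ρ)) u

/-- The formal derivative `d_i` of forms: the derivative at `t = 0` of the pull-back of `ρ` by
`u ↦ π_{k+1,k}(u) + t d_i(u)`. It is the total derivative on `0`-forms, commutes with `d`, obeys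
the Leibniz rule for the wedge product, and `d_i dx^j = 0`, `d_i dy^σ_I = dy^σ_{Ii}`. -/
def formalD {n m k q : ℕ} (i : Fin n) (ρ : LocForm n m k q) : LocForm n m (k + 1) q := fun u =>
  deriv (fun t : ℝ => (ρ (jetProj n m (k + 1) k u + t • totalVec i u)).compContinuousLinearMap
    (jetProj n m (k + 1) k + t • shift i)) 0

/-- Iterated formal derivative of forms along a tuple of indices. -/
def formalDs {n m k q : ℕ} : (J : List (Fin n)) → LocForm n m k q → LocForm n m (k + J.length) q
  | [], ρ => ρ
  | i :: J, ρ => formalD i (formalDs J ρ)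

/-- Contraction `V ⌋ ρ` of a form with a vector field. -/
def contract {n m k q : ℕ} (V : JetCoord n m k → JetCoord n m k) (ρ : LocForm n m k (q + 1)) :
    LocForm n m k q := fun u => (ρ u).curryLeft (V u)

/-- The coordinate vector field `∂/∂y^σ_I`. -/
def coordVec {n m k : ℕ} (I : MultiIndex n k) (σ : Fin m) : JetCoord n m k → JetCoord n m k :=
  fun _ => (0, Pi.single I (Pi.single σ 1))

/-- The wedge product `α ∧ β` of a `1`-form and a `q`-form (at one point). -/
def wedge {n m k q : ℕ} (α : JetCoord n m k →L[ℝ] ℝ) (β : (JetCoord n m k) [⋀^Fin q]→L[ℝ] ℝ) :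
    (JetCoord n m k) [⋀^Fin (q + 1)]→L[ℝ] ℝ :=
  ContinuousAlternatingMap.alternatizeUncurryFin (α.smulRight β)

/-- The interior Euler operator on `(n+1)`-forms of order `r`:
`I(η) = ω^σ ∧ ∑_{|I| ≤ r} (-1)^{|I|} d_I (∂/∂y^σ_I ⌋ p_1 η)`, a form of order `2r+1`. -/
def interiorEuler {n m r : ℕ} (η : LocForm n m r (n + 1)) : LocForm n m (2 * r + 1) (n + 1) :=
  fun u => ∑ σ : Fin m, wedge (contactForm (MultiIndex.zero n (2 * r)) σ u)
    (∑ I : MultiIndex n r, (-1 : ℝ) ^ I.len •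
      pull (2 * r + 1) (formalDs I.tuple (contract (coordVec I.lift σ) (contactPart 1 η))) u)

/-- The part of the `k`-th jet prolongation that lies over a set of points `W`. -/
def jetsOver {n m : ℕ} (k : ℕ) (W : Set (FibCoord n m)) : Set (JetCoord n m k) :=
  {u | toFib u ∈ W}

/-- `R` is a residual form of the `(n+1)`-form `η` over `W`: a strongly contact `n`-form
(that is, `p_0 R = 0`) such that, up to pull-backs, `p_1 η = I(η) + p_1 d p_1 R` over `W`. -/
structure IsResidual {n m r t : ℕ} (W : Set (FibCoord n m)) (η : LocForm n m r (n + 1))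
    (R : LocForm n m t n) : Prop where
  smooth : ContDiffOn ℝ ∞ R (jetsOver t W)
  strongly_contact : ∀ u ∈ jetsOver (t + 1) W, contactPart 0 R u = 0
  integration_by_parts : ∀ u ∈ jetsOver (max (2 * r + 1) (t + 2)) W,
    pull (max (2 * r + 1) (t + 2)) (contactPart 1 η) u =
      pull (max (2 * r + 1) (t + 2)) (interiorEuler η) u +
      pull (max (2 * r + 1) (t + 2)) (contactPart 1 (extDeriv (contactPart 1 R))) u

/-- Total derivative `d_i` of functions. -/
def totalDeriv {n m k : ℕ} (i : Fin n) (f : JetCoord n m k → ℝ) : JetCoord n m (k + 1) → ℝ :=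
  fun u => fderiv ℝ f (jetProj n m (k + 1) k u) (totalVec i u)

/-- Iterated total derivative of functions along a tuple of indices. -/
def totalDerivs {n m k : ℕ} :
    (J : List (Fin n)) → (JetCoord n m k → ℝ) → JetCoord n m (k + J.length) → ℝ
  | [], f => f
  | i :: J, f => totalDeriv i (totalDerivs J f)

/-- The prolongation `J^k ψ = ∑ d_I ψ^σ ∂/∂y^σ_I`, `|I| ≤ k`, of the vertical vector field
`ψ = ψ^σ ∂/∂y^σ`. -/
def prolong {n m : ℕ} (k : ℕ) (ψ : FibCoord n m → Fin m → ℝ) : JetCoord n m k → JetCoord n m k :=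
  fun u => (0, fun I σ => totalDerivs I.tuple (fun w : JetCoord n m 0 => ψ (toFib w) σ)
    (jetProj n m k (0 + I.tuple.length) u))

/-- The Noether current `J ψ ⌋ (- p_1 R)` that a vertical vector field `ψ` and a residual form
`R` of `dλ` define for the Lagrangian `λ`. -/
def noetherCurrent {n m t : ℕ} (ψ : FibCoord (n + 1) m → Fin m → ℝ)
    (R : LocForm (n + 1) m t (n + 1)) : LocForm (n + 1) m (t + 1) n :=
  contract (prolong (t + 1) ψ) (fun u => -contactPart 1 R u)

/-- The contraction `ψ ⌋ I(dλ)` of the Euler--Lagrange form of the Lagrangian `λ` with the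
(prolonged) vertical vector field `ψ`. -/
def contractEL {n m s : ℕ} (ψ : FibCoord n m → Fin m → ℝ) (L : LocForm n m s n) :
    LocForm n m (2 * s + 1) n :=
  contract (prolong (2 * s + 1) ψ) (interiorEuler (extDeriv L))

/-! ### Fibrations, fibered charts, forms on jet prolongations -/

section Fibration

variable (n m : ℕ)
  {X : Type*} [TopologicalSpace X] [ChartedSpace (Fin n → ℝ) X]
  {Y : Type*} [TopologicalSpace Y] [ChartedSpace (FibCoord n m) Y]

/-- A fibration (fibered manifold): a smooth surjective submersion. -/
structure IsFibration (π : Y → X) : Prop where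
  smooth : ContMDiff 𝓘(ℝ, FibCoord n m) 𝓘(ℝ, Fin n → ℝ) ∞ π
  surjective : Function.Surjective π
  submersion : ∀ p, Function.Surjective
    (mfderiv 𝓘(ℝ, FibCoord n m) 𝓘(ℝ, Fin n → ℝ) π p)

/-- Fibered coordinates `(x^i, y^σ)`: a smooth chart of `Y` whose first component is a smooth
chart of `X` composed with `π`. -/
structure FiberedChart (π : Y → X) where
  chart : OpenPartialHomeomorph Y (FibCoord n m)
  base : OpenPartialHomeomorph X (Fin n → ℝ)
  chart_mem : chart ∈ IsManifold.maximalAtlas 𝓘(ℝ, FibCoord n m) ∞ Y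
  base_mem : base ∈ IsManifold.maximalAtlas 𝓘(ℝ, Fin n → ℝ) ∞ X
  proj_mem : ∀ p ∈ chart.source, π p ∈ base.source
  fst_eq : ∀ p ∈ chart.source, (chart p).1 = base (π p)

variable {n m}

/-- The coordinates of the `k`-jet at `x` of the section `z ↦ (z, f z)`. -/
def jetOf (k : ℕ) (f : (Fin n → ℝ) → Fin m → ℝ) (x : Fin n → ℝ) : JetCoord n m k :=
  (x, fun I => iteratedFDeriv ℝ I.tuple.length f x (fun j => Pi.single (I.tuple.get j) 1))

/-- The polynomial section with prescribed `k`-jet `u`. -/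
def taylor {k : ℕ} (u : JetCoord n m k) (z : Fin n → ℝ) : Fin m → ℝ :=
  ∑ I : MultiIndex n k, (∏ i, (z i - u.1 i) ^ I.1 i / ((I.1 i).factorial : ℝ)) • u.2 I

/-- The `k`-jets, in the coordinates of `c`, at points that also lie in the domain of `c'`. -/
def jetOverlap {π : Y → X} (k : ℕ) (c c' : FiberedChart n m π) : Set (JetCoord n m k) :=
  {u | toFib u ∈ c.chart.target ∧ c.chart.symm (toFib u) ∈ c'.chart.source}

/-- The change of coordinates on the `k`-th jet prolongation from `c` to `c'`: rewrite a section
with the given jet in the coordinates `c'` and take its jet there. -/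
def jetTransition {π : Y → X} (k : ℕ) (c c' : FiberedChart n m π) (u : JetCoord n m k) :
    JetCoord n m k :=
  jetOf k
    (fun z' => (c'.chart (c.chart.symm
      (c.base (c'.base.symm z'), taylor u (c.base (c'.base.symm z'))))).2)
    (c'.base (c.base.symm u.1))

variable (n m) in
/-- A (global, smooth) differential `q`-form on the `k`-th jet prolongation `J^k Y`. The manifold
`J^k Y` is glued from the jet coordinate domains of the fibered charts along the changes of
coordinates, so a form is a family of forms in the induced coordinates of all the fibered charts
that are pull-backs of each other along the changes of coordinates. (Values outside the
coordinate domain carry no meaning.) -/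
structure JetForm (π : Y → X) (k q : ℕ) where
  repr : FiberedChart n m π → LocForm n m k q
  smooth : ∀ c, ContDiffOn ℝ ∞ (repr c) (jetsOver k c.chart.target)
  compat : ∀ c c', ∀ u ∈ jetOverlap k c c',
    repr c u = (repr c' (jetTransition k c c' u)).compContinuousLinearMap
      (fderiv ℝ (jetTransition k c c') u)

/-- The fibre components `ψ^σ` in a fibered chart of a vector field `ψ` on `Y`. -/
def fibreComponents {π : Y → X} (c : FiberedChart n m π)
    (ψ : (p : Y) → TangentSpace 𝓘(ℝ, FibCoord n m) p) : FibCoord n m → Fin m → ℝ := fun z =>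
  ((mfderiv 𝓘(ℝ, FibCoord n m) 𝓘(ℝ, FibCoord n m) c.chart (c.chart.symm z)
    (ψ (c.chart.symm z)) : FibCoord n m)).2

variable (n m) in
/-- A smooth vertical vector field on `Y`. -/
structure VerticalField [IsManifold 𝓘(ℝ, FibCoord n m) ∞ Y] (π : Y → X) where
  field : (p : Y) → TangentSpace 𝓘(ℝ, FibCoord n m) p
  smooth : ContMDiff 𝓘(ℝ, FibCoord n m) 𝓘(ℝ, FibCoord n m).tangent ∞
    (fun p => (⟨p, field p⟩ : TangentBundle 𝓘(ℝ, FibCoord n m) Y))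
  vertical : ∀ p, mfderiv 𝓘(ℝ, FibCoord n m) 𝓘(ℝ, Fin n → ℝ) π p (field p) = 0

end Fibration

end FiberedJet

end

open FiberedJet

noncomputable section

namespace FiberedJet

/-! ### Algebra of the formal calculus of variations -/

/-! Over one fibered chart the identity is an identity between coefficient functions of the volume
form, and these live in the algebra `JetFun` of smooth functions of finite order on infinite jets.
On infinite jets no operator raises the order, so pull-backs disappear, and only formal properties
are needed: the total derivatives commute, the vertical differential intertwines them with the Lie
derivatives of contact forms, and second vertical derivatives are symmetric. `VariationalAlgebra`
records these properties and `jetAlgebra` establishes them for `JetFun`.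

Write `E` for the Euler–Lagrange expressions of `a` and `Jψ` for the prolonged field. Integration by
parts (`exists_integration_by_parts`) makes `Jψ(a) - ψ·E(a)` a divergence, and `E` kills
divergences, so `E(ψ₂·E(a)) = E(Jψ₂(a))` (`euler_evol`). For `ψ` of order zero, `E_σ(Jψ(a)) =
Jψ(E_σ(a)) + ∑ E_ν(a) ∂ψ^ν/∂y^σ` (`euler_evol_eq`); this is where the symmetry of second derivatives
enters. Contracting with `ψ₁` and using the Leibniz rule gives `second_variation`: `ψ₁·E(ψ₂·E(a)) =
Jψ₂(ψ₁·E(a)) + [ψ₁,ψ₂]·E(a)`.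

It remains to recognise `Jψ₂(ψ₁·E(a)) - ψ₂·E(ψ₁·E(a))` as the coefficient of the horizontal
differential of the Noether current. This is the first variation formula for the Lagrangian
`ψ₁·E(a)`, valid for any residual form (`IsResidual.evol_eq`). It rests on `dH_noetherCurrent`,
which computes the differential of the current from `d p_1 R`. Existence of a residual form
(`exists_isResidual`) turns the algebraic integration by parts into an explicit contact form. -/

/-- Labels `(I, σ)` of the fibre coordinates `y^σ_I` of all orders. -/
abbrev Idx (n m : ℕ) : Type := (Fin n → ℕ) × Fin m

/-- The label `(I i, σ)`. -/
def Idx.snoc {n m : ℕ} (i : Fin n) (p : Idx n m) : Idx n m := (p.1 + Pi.single i 1, p.2)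

/-- The increasing tuple with given multiplicities. -/
def tupleOf {n : ℕ} (I : Fin n → ℕ) : List (Fin n) :=
  (List.finRange n).flatMap fun i => List.replicate (I i) i

theorem count_tupleOf {n : ℕ} (I : Fin n → ℕ) (j : Fin n) : (tupleOf I).count j = I j := by
  rw [tupleOf, List.count_flatMap, List.sum_map_eq_nsmul_single j]
  · simp [List.count_eq_one_of_mem (List.nodup_finRange n)]
  · intro i hi _
    simp [List.count_replicate, hi]

theorem tupleOf_zero {n : ℕ} : tupleOf (0 : Fin n → ℕ) = [] := by
  simp [tupleOf]

/-- Sorting puts `i` somewhere in the middle of the tuple, so only a permutation is available; since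
total derivatives commute, this suffices for `DI_snoc`. -/
theorem tupleOf_add_single {n : ℕ} (I : Fin n → ℕ) (i : Fin n) :
    (tupleOf (I + Pi.single i 1)).Perm (i :: tupleOf I) := by
  rw [List.perm_iff_count]
  intro j
  rw [List.count_cons, count_tupleOf, count_tupleOf, Pi.add_apply, Pi.single_apply]
  by_cases h : i = j
  · simp [h]
  · simp [h, Ne.symm h]

theorem sum_add_single {n : ℕ} (I : Fin n → ℕ) (i : Fin n) :
    ∑ j, (I + Pi.single i 1 : Fin n → ℕ) j = ∑ j, I j + 1 := by
  simp [Finset.sum_add_distrib]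

theorem length_tupleOf {n : ℕ} (I : Fin n → ℕ) : (tupleOf I).length = ∑ i, I i := by
  simp [tupleOf, List.length_flatMap, ← List.ofFn_eq_map, List.sum_ofFn]

section Algebra

variable {n m : ℕ} {A : Type*} [CommRing A] [Algebra ℝ A]

/-- The Lie derivative of formal contact forms along the total derivative in direction `i`:
`a ω^σ_I ↦ (d_i a) ω^σ_I + a ω^σ_{Ii}`. -/
def lieTotal (δ : Derivation ℝ A A) (i : Fin n) : (Idx n m →₀ A) →ₗ[ℝ] (Idx n m →₀ A) :=
  Finsupp.mapRange.linearMap δ.toLinearMap + Finsupp.lmapDomain A ℝ (Idx.snoc i)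

theorem lieTotal_single (δ : Derivation ℝ A A) (i : Fin n) (p : Idx n m) (a : A) :
    lieTotal δ i (Finsupp.single p a) = Finsupp.single p (δ a) + Finsupp.single (p.snoc i) a := by
  simp [lieTotal]

variable (n m A) in
/-- An algebra of functions of finite order on infinite jets: commuting total derivatives `D i`
and a vertical differential `dv` with values in the formal contact forms. -/
structure VariationalAlgebra where
  D : Fin n → Derivation ℝ A A
  dv : Derivation ℝ A (Idx n m →₀ A)
  D_comm : ∀ i j a, D i (D j a) = D j (D i a)
  dv_D : ∀ i a, dv (D i a) = lieTotal (D i) i (dv a)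
  dv_symm : ∀ a p q, dv (dv a p) q = dv (dv a q) p

namespace VariationalAlgebra

variable (V : VariationalAlgebra n m A)

/-- Iterated total derivatives along a tuple. -/
def iter (J : List (Fin n)) : Module.End ℝ A :=
  (J.map fun i => ((V.D i).toLinearMap : Module.End ℝ A)).prod

theorem iter_cons (i : Fin n) (J : List (Fin n)) (a : A) :
    V.iter (i :: J) a = V.D i (V.iter J a) := by
  simp [iter]

theorem iter_perm {J K : List (Fin n)} (h : J.Perm K) (a : A) : V.iter J a = V.iter K a := by
  induction h with
  | nil => rfl
  | cons x _ ih => rw [iter_cons, iter_cons, ih]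
  | swap x y l => simp only [iter_cons]; rw [V.D_comm]
  | trans _ _ h1 h2 => rw [h1, h2]

/-- The iterated total derivative `d_I`. -/
def DI (I : Fin n → ℕ) : Module.End ℝ A := V.iter (tupleOf I)

theorem DI_zero (a : A) : V.DI 0 a = a := by
  simp [DI, tupleOf_zero, iter]

theorem DI_snoc (I : Fin n → ℕ) (i : Fin n) (a : A) :
    V.DI (I + Pi.single i 1) a = V.D i (V.DI I a) := by
  rw [DI, V.iter_perm (tupleOf_add_single I i), iter_cons, DI]

theorem D_iter (i : Fin n) (J : List (Fin n)) (a : A) :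
    V.D i (V.iter J a) = V.iter J (V.D i a) := by
  induction J with
  | nil => simp [iter]
  | cons j J ih => rw [iter_cons, iter_cons, V.D_comm, ih]

theorem D_DI (i : Fin n) (I : Fin n → ℕ) (a : A) : V.D i (V.DI I a) = V.DI I (V.D i a) :=
  V.D_iter i _ a

theorem multiIndex_induction {P : (Fin n → ℕ) → Prop} (h0 : P 0)
    (hs : ∀ I i, P I → P (I + Pi.single i 1)) (I : Fin n → ℕ) : P I := by
  induction h : ∑ i, I i generalizing I with
  | zero =>
    have : I = 0 := by
      funext i
      exact (Finset.sum_eq_zero_iff.1 h) i (Finset.mem_univ i)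
    rwa [this]
  | succ k ih =>
    obtain ⟨i, -, hi⟩ : ∃ i ∈ Finset.univ, I i ≠ 0 :=
      Finset.exists_ne_zero_of_sum_ne_zero (by omega)
    have hI : I = (I - Pi.single i 1) + Pi.single i 1 := by
      funext j
      by_cases hj : j = i
      · subst hj; simp; omega
      · simp [hj]
    rw [hI]
    refine hs _ _ (ih _ ?_)
    have h2 := sum_add_single (I - Pi.single i 1) i
    rw [← hI] at h2
    omega

/-! ### Interior Euler operator, contraction and integration by parts. -/

/-- The coefficient at `ω^σ` of the interior Euler operator on formal contact forms. -/
def interior (σ : Fin m) : (Idx n m →₀ A) →ₗ[ℝ] A :=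
  Finsupp.lsum ℝ fun p : Idx n m => if p.2 = σ then (-1 : ℝ) ^ (∑ i, p.1 i) • V.DI p.1 else 0

theorem interior_single (σ : Fin m) (p : Idx n m) (a : A) :
    V.interior σ (Finsupp.single p a) =
      if p.2 = σ then (-1 : ℝ) ^ (∑ i, p.1 i) • V.DI p.1 a else 0 := by
  rw [interior, Finsupp.lsum_single]
  split_ifs <;> simp

/-- Both terms of the Lie derivative of `a ω_I` contribute `d_I d_i a`, with opposite signs because
`I i` is one longer than `I`. -/
theorem interior_lieTotal (σ : Fin m) (i : Fin n) (μ : Idx n m →₀ A) :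
    V.interior σ (lieTotal (V.D i) i μ) = 0 := by
  induction μ using Finsupp.induction_linear with
  | zero => simp
  | add f g hf hg => rw [map_add, map_add, hf, hg, add_zero]
  | single p a =>
    rw [lieTotal_single, map_add, interior_single, interior_single]
    by_cases h : p.2 = σ
    · simp only [Idx.snoc, h, if_true, sum_add_single, DI_snoc, D_DI, pow_succ]
      simp
    · simp [Idx.snoc, h]

/-- Contraction of formal contact forms with the prolongation of `ψ`. -/
def contraction (ψ : Fin m → A) : (Idx n m →₀ A) →ₗ[A] A :=
  Finsupp.linearCombination A fun p => V.DI p.1 (ψ p.2)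

theorem contraction_single (ψ : Fin m → A) (p : Idx n m) (a : A) :
    V.contraction ψ (Finsupp.single p a) = a * V.DI p.1 (ψ p.2) := by
  simp [contraction]

/-- The `I i` component of a prolongation is `d_i` of its `I` component, so this is the Leibniz rule
for `d_i` of a product. -/
theorem contraction_lieTotal (ψ : Fin m → A) (i : Fin n) (μ : Idx n m →₀ A) :
    V.contraction ψ (lieTotal (V.D i) i μ) = V.D i (V.contraction ψ μ) := by
  induction μ using Finsupp.induction_linear with
  | zero => simp
  | add f g hf hg => rw [map_add, map_add, hf, hg, map_add, map_add]
  | single p a =>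
    rw [lieTotal_single, map_add, contraction_single, contraction_single, contraction_single,
      Idx.snoc, DI_snoc, Derivation.leibniz, smul_eq_mul, smul_eq_mul]
    ring

/-- Integration by parts: a formal contact form is its interior Euler part up to a divergence. -/
theorem exists_integration_by_parts (μ : Idx n m →₀ A) :
    ∃ β : Fin n → Idx n m →₀ A, μ = ∑ σ, Finsupp.single (0, σ) (V.interior σ μ) +
      ∑ i, lieTotal (V.D i) i (β i) := by
  induction μ using Finsupp.induction_linear with
  | zero => exact ⟨0, by simp⟩
  | add f g hf hg =>
    obtain ⟨β, hβ⟩ := hf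
    obtain ⟨γ, hγ⟩ := hg
    refine ⟨β + γ, ?_⟩
    simp only [map_add, Finsupp.single_add, Finset.sum_add_distrib, Pi.add_apply]
    nth_rw 1 [hβ, hγ]
    abel
  | single p a =>
    obtain ⟨I, τ⟩ := p
    induction I using multiIndex_induction generalizing a with
    | h0 =>
      refine ⟨0, ?_⟩
      rw [Finset.sum_eq_single τ]
      · simp [interior_single, DI_zero]
      · intro σ _ h
        simp [interior_single, h.symm]
      · simp
    | hs I i ih =>
      -- One step of integration by parts: `a ω_{Ii} = L_i(a ω_I) - (d_i a) ω_I`. The first term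
      -- goes into `β i`, the second is shorter.
      obtain ⟨β, hβ⟩ := ih (-V.D i a)
      refine ⟨β + Pi.single i (Finsupp.single (I, τ) a), ?_⟩
      have h1 : Finsupp.single (I + Pi.single i 1, τ) a =
          Finsupp.single (I, τ) (-V.D i a) +
            lieTotal (V.D i) i (Finsupp.single ((I, τ) : Idx n m) a) := by
        rw [lieTotal_single, Idx.snoc]; simp
      have h2 : ∑ j, lieTotal (m := m) (V.D j) j
          ((Pi.single i (Finsupp.single (I, τ) a) : Fin n → Idx n m →₀ A) j) =
            lieTotal (V.D i) i (Finsupp.single ((I, τ) : Idx n m) a) := by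
        rw [Finset.sum_eq_single i]
        · simp
        · intro j _ h
          simp [h]
        · simp
      simp only [Pi.add_apply, map_add, Finset.sum_add_distrib, h2]
      rw [h1]
      simp only [map_add, interior_lieTotal, add_zero]
      nth_rw 1 [hβ]
      abel

/-! ### Euler–Lagrange expressions, evolutionary fields and the second variation. -/

/-- The Euler--Lagrange expressions. -/
def euler (σ : Fin m) : A →ₗ[ℝ] A := V.interior σ ∘ₗ V.dv.toLinearMap

theorem euler_apply (σ : Fin m) (a : A) : V.euler σ a = V.interior σ (V.dv a) := rfl

theorem euler_D (σ : Fin m) (i : Fin n) (a : A) : V.euler σ (V.D i a) = 0 := by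
  rw [euler_apply, V.dv_D, interior_lieTotal]

/-- The prolongation of the evolutionary field `ψ`. -/
def evol (ψ : Fin m → A) : Derivation ℝ A A :=
  Derivation.mk' ((V.contraction ψ).restrictScalars ℝ ∘ₗ V.dv.toLinearMap) fun a b => by
    simp

theorem evol_apply (ψ : Fin m → A) (a : A) : V.evol ψ a = V.contraction ψ (V.dv a) := rfl

theorem evol_D (ψ : Fin m → A) (i : Fin n) (a : A) :
    V.evol ψ (V.D i a) = V.D i (V.evol ψ a) := by
  rw [evol_apply, V.dv_D, contraction_lieTotal, evol_apply]

theorem evol_DI (ψ : Fin m → A) (I : Fin n → ℕ) (a : A) :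
    V.evol ψ (V.DI I a) = V.DI I (V.evol ψ a) := by
  induction I using multiIndex_induction with
  | h0 => simp [DI_zero]
  | hs I i ih => rw [DI_snoc, DI_snoc, evol_D, ih]

/-- First variation formula: `Jψ(a) - ψ^σ E_σ(a)` is a divergence. -/
theorem exists_evol_eq (ψ : Fin m → A) (a : A) : ∃ b : Fin n → A,
    V.evol ψ a = ∑ σ, ψ σ * V.euler σ a + ∑ i, V.D i (b i) := by
  obtain ⟨β, hβ⟩ := V.exists_integration_by_parts (V.dv a)
  -- Contraction with a prolongation turns the Lie derivatives of the `β i` into total derivatives.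
  refine ⟨fun i => V.contraction ψ (β i), ?_⟩
  rw [evol_apply]
  conv_lhs => rw [hβ]
  simp only [map_add, map_sum, contraction_single, contraction_lieTotal, DI_zero, ← euler_apply]
  congr 1
  exact Finset.sum_congr rfl fun σ _ => mul_comm _ _

/-- By the first variation formula the two arguments differ by a divergence, which the
Euler–Lagrange expressions do not see. -/
theorem euler_evol (ψ : Fin m → A) (σ : Fin m) (a : A) :
    V.euler σ (V.evol ψ a) = V.euler σ (∑ ν, ψ ν * V.euler ν a) := by
  obtain ⟨b, hb⟩ := V.exists_evol_eq ψ a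
  have h : V.euler σ (∑ i, V.D i (b i)) = 0 := by
    rw [map_sum]
    exact Finset.sum_eq_zero fun i _ => V.euler_D σ i _
  rw [hb, map_add, h, add_zero]

/-- The interior Euler operator annihilates the Lie derivative of `a • μ`; expanding that by Leibniz
moves the derivative from `μ` to `a`. -/
theorem interior_smul_lieTotal (σ : Fin m) (i : Fin n) (a : A) (μ : Idx n m →₀ A) :
    V.interior σ (a • lieTotal (V.D i) i μ) = V.interior σ ((-V.D i a) • μ) := by
  have h : lieTotal (V.D i) i (a • μ) = V.D i a • μ + a • lieTotal (V.D i) i μ := by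
    induction μ using Finsupp.induction_linear with
    | zero => simp
    | add f g hf hg => rw [smul_add, map_add, hf, hg, map_add, smul_add, smul_add]; abel
    | single p b =>
      rw [lieTotal_single, Finsupp.smul_single, lieTotal_single, smul_eq_mul, Derivation.leibniz,
        smul_add, Finsupp.smul_single, Finsupp.smul_single, Finsupp.smul_single, Finsupp.single_add]
      simp only [smul_eq_mul]
      rw [mul_comm b (V.D i a)]
      abel
  have h2 := V.interior_lieTotal σ i (a • μ)
  rw [h, map_add] at h2
  rw [neg_smul, map_neg]
  exact eq_neg_of_add_eq_zero_right h2

/-- Repeated integration by parts: under the interior Euler operator the adjoint of `d_I` is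
`(-1)^|I| d_I`. -/
theorem interior_smul_dv_DI (σ : Fin m) (I : Fin n → ℕ) (a b : A) :
    V.interior σ (a • V.dv (V.DI I b)) =
      V.interior σ (((-1 : ℝ) ^ (∑ i, I i) • V.DI I a) • V.dv b) := by
  induction I using multiIndex_induction generalizing a with
  | h0 => simp [DI_zero]
  | hs I i ih =>
    rw [DI_snoc, V.dv_D, interior_smul_lieTotal, ih]
    rw [sum_add_single, DI_snoc, D_DI, pow_succ, map_neg]
    simp

/-- The core of the second variation. In `∑ b_p d_I ψ` with `b_p` the coefficients of `dv a`, the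
Leibniz rule gives two kinds of terms. Where `dv` hits `d_I ψ`, integrating `d_I` back onto `b_p`
assembles the Euler–Lagrange expressions. Where it hits `b_p`, the symmetry of second vertical
derivatives turns the sum into `Jψ` acting on the coefficients of `dv a`. -/
theorem dv_contraction_apply (ψ : Fin m → A) (a : A) (σ : Fin m) :
    V.interior σ (V.dv (V.contraction ψ (V.dv a))) =
      V.evol ψ (V.euler σ a) +
        V.interior σ (∑ ν, V.euler ν a • V.dv (ψ ν)) := by
  -- The Leibniz split is linear in the contact form, so it is proved for arbitrary `μ`, on
  -- generators; `dv a` is special only in `h2`.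
  have h1 : ∀ μ : Idx n m →₀ A, V.interior σ (V.dv (V.contraction ψ μ)) =
      V.interior σ (μ.sum fun p b => V.DI p.1 (ψ p.2) • V.dv b) +
        V.interior σ (∑ ν, V.interior ν μ • V.dv (ψ ν)) := by
    intro μ
    induction μ using Finsupp.induction_linear with
    | zero => simp
    | add f g hf hg =>
      rw [map_add, map_add, map_add, hf, hg, Finsupp.sum_add_index']
      · simp only [map_add, add_smul, Finset.sum_add_distrib]
        abel
      · simp
      · intro p b₁ b₂; rw [map_add, smul_add]
    | single p b =>
      rw [contraction_single, Derivation.leibniz, map_add, Finsupp.sum_single_index (by simp),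
        interior_smul_dv_DI, add_comm]
      congr 2
      rw [Finset.sum_eq_single p.2]
      · rw [interior_single, if_pos rfl]
      · intro ν _ h
        rw [interior_single, if_neg h.symm, zero_smul]
      · simp
  have h2 : ((V.dv a).sum fun p b => V.DI p.1 (ψ p.2) • V.dv b) =
      Finsupp.mapRange.linearMap (V.evol ψ).toLinearMap (V.dv a) := by
    ext q
    rw [Finsupp.sum_apply]
    simp only [Finsupp.mapRange.linearMap_apply, Finsupp.mapRange_apply, Finsupp.smul_apply,
      smul_eq_mul]
    have h3 : V.evol ψ (V.dv a q) = (V.dv (V.dv a q)).sum fun p b => b * V.DI p.1 (ψ p.2) := by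
      rw [evol_apply, contraction, Finsupp.linearCombination_apply]
      rfl
    refine Eq.trans ?_ h3.symm
    rw [Finsupp.sum_of_support_subset (V.dv a) (s := (V.dv a).support ∪ (V.dv (V.dv a q)).support)
        Finset.subset_union_left _ (by simp),
      Finsupp.sum_of_support_subset _ (s := (V.dv a).support ∪ (V.dv (V.dv a q)).support)
        Finset.subset_union_right _ (by simp)]
    refine Finset.sum_congr rfl fun p _ => ?_
    rw [V.dv_symm, mul_comm]
  -- `Jψ` commutes with every `d_I`, hence its coefficientwise action commutes with the interior
  -- Euler operator.
  have h4 : ∀ μ : Idx n m →₀ A,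
      V.interior σ (Finsupp.mapRange.linearMap (V.evol ψ).toLinearMap μ) =
        V.evol ψ (V.interior σ μ) := by
    intro μ
    induction μ using Finsupp.induction_linear with
    | zero => simp
    | add f g hf hg => rw [map_add, map_add, hf, hg, map_add, map_add]
    | single p b =>
      rw [Finsupp.mapRange.linearMap_apply, Finsupp.mapRange_single, interior_single,
        interior_single]
      split_ifs
      · rw [Derivation.map_smul, evol_DI]; rfl
      · simp
  rw [h1, h2, h4]
  rfl

theorem interior_smul_of_order_zero (σ : Fin m) (a : A) (μ : Idx n m →₀ A)
    (hμ : ∀ p : Idx n m, p.1 ≠ 0 → μ p = 0) :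
    V.interior σ (a • μ) = a * μ (0, σ) := by
  rw [interior, Finsupp.lsum_apply, Finsupp.sum, Finset.sum_eq_single (0, σ)]
  · simp [DI_zero]
  · intro p _ hp
    by_cases h0 : p.1 = 0
    · have : p.2 ≠ σ := fun h => hp (Prod.ext h0 h)
      simp [this]
    · rw [Finsupp.smul_apply, hμ p h0, smul_zero, map_zero]
  · intro h
    rw [Finsupp.notMem_support_iff.1 h, map_zero]

/-- The Euler--Lagrange expressions commute with evolutionary fields of order zero up to the
linear action on their index. -/
theorem euler_evol_eq (ψ : Fin m → A)
    (hψ : ∀ ν (p : Idx n m), p.1 ≠ 0 → V.dv (ψ ν) p = 0) (σ : Fin m) (a : A) :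
    V.euler σ (V.evol ψ a) = V.evol ψ (V.euler σ a) +
      ∑ ν, V.euler ν a * V.dv (ψ ν) (0, σ) := by
  rw [euler_apply V σ (V.evol ψ a), evol_apply, dv_contraction_apply, map_sum]
  congr 1
  exact Finset.sum_congr rfl fun ν _ => V.interior_smul_of_order_zero σ _ _ (hψ ν)

/-- Only the components of the prolongation with empty multi-index meet `dv a`. This identifies `∑
ψ^σ ∂a/∂y^σ`, from which the bracket is built, with `Jψ(a)`. -/
theorem evol_of_order_zero (ψ : Fin m → A) (a : A)
    (ha : ∀ p : Idx n m, p.1 ≠ 0 → V.dv a p = 0) :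
    V.evol ψ a = ∑ σ, ψ σ * V.dv a (0, σ) := by
  have h : V.dv a = ∑ σ, Finsupp.single (0, σ) (V.dv a (0, σ)) := by
    ext ⟨I, τ⟩
    rw [Finsupp.finsetSum_apply]
    by_cases hI : I = 0
    · subst hI
      rw [Finset.sum_eq_single τ]
      · simp
      · intro σ _ hσ
        rw [Finsupp.single_apply, if_neg]
        simpa using hσ
      · simp
    · rw [ha _ hI, Finset.sum_eq_zero]
      intro σ _
      rw [Finsupp.single_apply, if_neg]
      simpa using fun h => absurd h.symm hI
  rw [evol_apply]
  conv_lhs => rw [h]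
  simp only [map_sum, contraction_single, DI_zero]
  exact Finset.sum_congr rfl fun σ _ => mul_comm _ _

/-- The second variation identity for Euler--Lagrange expressions. -/
theorem second_variation (ψ₁ ψ₂ : Fin m → A)
    (h₁ : ∀ ν (p : Idx n m), p.1 ≠ 0 → V.dv (ψ₁ ν) p = 0)
    (h₂ : ∀ ν (p : Idx n m), p.1 ≠ 0 → V.dv (ψ₂ ν) p = 0) (a : A) :
    ∑ σ, ψ₁ σ * V.euler σ (∑ ν, ψ₂ ν * V.euler ν a) =
      V.evol ψ₂ (∑ σ, ψ₁ σ * V.euler σ a) +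
        ∑ ν, (∑ σ, (ψ₁ σ * V.dv (ψ₂ ν) (0, σ) - ψ₂ σ * V.dv (ψ₁ ν) (0, σ))) * V.euler ν a := by
  have h0 : ∀ σ, V.euler σ (∑ ν, ψ₂ ν * V.euler ν a) = V.evol ψ₂ (V.euler σ a) +
      ∑ ν, V.euler ν a * V.dv (ψ₂ ν) (0, σ) := fun σ => by
    rw [← euler_evol, V.euler_evol_eq ψ₂ h₂]
  -- Expanding `Jψ₂(ψ₁^σ E_σ)` cancels the terms `ψ₁^σ Jψ₂(E_σ)`; the rest is `Jψ₁(ψ₂^ν) -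
  -- Jψ₂(ψ₁^ν)`, the bracket components, times `E_ν`.
  simp only [h0, map_sum, Derivation.leibniz, smul_eq_mul,
    Finset.sum_add_distrib, mul_add, Finset.sum_sub_distrib, sub_mul,
    ← V.evol_of_order_zero _ _ (h₁ _), ← V.evol_of_order_zero _ _ (h₂ _)]
  have h : ∑ σ, ψ₁ σ * ∑ ν, V.euler ν a * V.dv (ψ₂ ν) (0, σ) =
      ∑ ν, V.evol ψ₁ (ψ₂ ν) * V.euler ν a := by
    simp only [V.evol_of_order_zero _ _ (h₂ _), Finset.mul_sum, Finset.sum_mul]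
    rw [Finset.sum_comm]
    exact Finset.sum_congr rfl fun _ _ => Finset.sum_congr rfl fun _ _ => by ring
  rw [h]
  have h' : ∑ ν, V.euler ν a * V.evol ψ₂ (ψ₁ ν) = ∑ ν, V.evol ψ₂ (ψ₁ ν) * V.euler ν a :=
    Finset.sum_congr rfl fun _ _ => mul_comm _ _
  rw [h']
  ring

end VariationalAlgebra

end Algebra

/-! ### Infinite jets and smooth functions of finite order -/

section InfiniteJets

variable {n m : ℕ}

variable (n m) in
/-- Coordinates of infinite jets. -/
abbrev InfJet : Type := (Fin n → ℝ) × (Idx n m → ℝ)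

/-- The projection from infinite jets to `k`-jets. -/
def trunc (k : ℕ) : InfJet n m →ₗ[ℝ] JetCoord n m k where
  toFun u := (u.1, fun I σ => u.2 (I.1, σ))
  map_add' _ _ := rfl
  map_smul' _ _ := rfl

/-- Extension of `k`-jets by zero. -/
def extend {k : ℕ} (u : JetCoord n m k) : InfJet n m :=
  (u.1, fun p => if h : ∑ i, p.1 i ≤ k then u.2 ⟨p.1, h⟩ p.2 else 0)

theorem trunc_extend {k : ℕ} (u : JetCoord n m k) : trunc k (extend u) = u := by
  refine Prod.ext rfl ?_
  funext I σ
  simp [trunc, extend, I.2]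

theorem jetProj_snd {k l : ℕ} (h : k ≤ l) (u : JetCoord n m l) (I : MultiIndex n k) :
    (jetProj n m l k u).2 I = u.2 ⟨I.1, I.2.trans h⟩ := by
  simp [jetProj, I.2.trans h]

theorem jetProj_trunc {k l : ℕ} (h : k ≤ l) (u : InfJet n m) :
    jetProj n m l k (trunc l u) = trunc k u := by
  refine Prod.ext rfl ?_
  funext I
  rw [jetProj_snd h]
  rfl

theorem trunc_extend_of_le {k l : ℕ} (h : k ≤ l) (u : JetCoord n m l) :
    trunc k (extend u) = jetProj n m l k u := by
  rw [← jetProj_trunc h, trunc_extend]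

theorem toFib_jetProj {k l : ℕ} (u : JetCoord n m l) :
    toFib (jetProj n m l k u) = toFib u := by
  refine Prod.ext rfl ?_
  simp [toFib, jetProj, MultiIndex.zero]

theorem continuous_toFib {k : ℕ} : Continuous (toFib : JetCoord n m k → FibCoord n m) := by
  unfold toFib
  fun_prop

theorem contDiff_totalVec {k : ℕ} (i : Fin n) :
    ContDiff ℝ ∞ (totalVec (n := n) (m := m) (k := k) i) := by
  unfold totalVec
  fun_prop

/-- The total derivative field is affine in the jet coordinates, with linear part `shift`. -/
theorem hasFDerivAt_totalVec {k : ℕ} (i : Fin n) (u : JetCoord n m (k + 1)) :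
    HasFDerivAt (totalVec (k := k) i) (shift i) u := by
  have h : totalVec (k := k) i = fun u : JetCoord n m (k + 1) =>
      ((Pi.single i 1, 0) : JetCoord n m k) + shift i u := by
    funext u
    refine Prod.ext ?_ ?_
    · simp [totalVec, shift]
    · funext I
      simp [totalVec, shift]
  rw [h]
  exact (shift i).hasFDerivAt.const_add _

/-- The total derivative as a vector field on infinite jets. -/
def totalInf (i : Fin n) (u : InfJet n m) : InfJet n m := (Pi.single i 1, fun p => u.2 (p.snoc i))

/-- The linear part of `totalInf`. -/
def shiftInf (i : Fin n) (w : InfJet n m) : InfJet n m := (0, fun p => w.2 (p.snoc i))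

/-- The coordinate vector of a fibre coordinate. -/
def coordInf (p : Idx n m) : InfJet n m := (0, Pi.single p 1)

theorem trunc_totalInf {k : ℕ} (i : Fin n) (u : InfJet n m) :
    trunc k (totalInf i u) = totalVec i (trunc (k + 1) u) := rfl

theorem trunc_shiftInf {k : ℕ} (i : Fin n) (w : InfJet n m) :
    trunc k (shiftInf i w) = shift i (trunc (k + 1) w) := rfl

theorem trunc_coordInf {k : ℕ} (I : MultiIndex n k) (σ : Fin m) :
    trunc k (coordInf (I.1, σ)) = coordVec I σ 0 := by
  refine Prod.ext rfl ?_
  funext J τ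
  by_cases h : J = I
  · subst h
    simp [trunc, coordInf, coordVec, Pi.single_apply]
  · have h' : J.1 ≠ I.1 := fun e => h (Subtype.ext e)
    simp [trunc, coordInf, coordVec, h, h']

theorem trunc_coordInf_of_lt {k : ℕ} {p : Idx n m} (h : k < ∑ i, p.1 i) :
    trunc k (coordInf p) = 0 := by
  refine Prod.ext rfl ?_
  funext J τ
  have h' : ((J.1, τ) : Idx n m) ≠ p := by
    rintro rfl
    exact absurd J.2 (not_le.2 h)
  simp [trunc, coordInf, h']

theorem shiftInf_totalInf (i j : Fin n) (u : InfJet n m) :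
    shiftInf i (totalInf j u) = shiftInf j (totalInf i u) := by
  refine Prod.ext rfl ?_
  funext p
  simp only [shiftInf, totalInf, Idx.snoc, add_assoc, add_comm (Pi.single i 1 : Fin n → ℕ)]

theorem snoc_injective (i : Fin n) : Function.Injective (Idx.snoc i : Idx n m → Idx n m) := by
  rintro ⟨I, σ⟩ ⟨J, τ⟩ h
  simpa [Idx.snoc] using h

theorem shiftInf_coordInf_snoc (i : Fin n) (p : Idx n m) :
    shiftInf i (coordInf (p.snoc i)) = coordInf p := by
  refine Prod.ext rfl ?_
  funext q
  simp [shiftInf, coordInf, Pi.single_apply, (snoc_injective i).eq_iff]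

theorem shiftInf_coordInf_of_notMem (i : Fin n) (p : Idx n m) (h : p ∉ Set.range (Idx.snoc i)) :
    shiftInf i (coordInf p) = 0 := by
  refine Prod.ext rfl ?_
  funext q
  have : q.snoc i ≠ p := fun e => h ⟨q, e⟩
  simp [shiftInf, coordInf, this]

end InfiniteJets

/-! ### Functions of finite order over an open set and their variational algebra. -/

section JetFunctions

variable {n m : ℕ} {W : TopologicalSpace.Opens (FibCoord n m)}

theorem isOpen_jetsOver (k : ℕ) : IsOpen (jetsOver k (W : Set (FibCoord n m))) :=
  W.isOpen.preimage continuous_toFib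

theorem jetProj_mem_jetsOver {k l : ℕ} {u : JetCoord n m l} {W : Set (FibCoord n m)} :
    jetProj n m l k u ∈ jetsOver k W ↔ u ∈ jetsOver l W := by
  simp [jetsOver, toFib_jetProj]

variable (W) in
/-- Infinite jets over `W`. -/
abbrev InfOver : Type := {u : InfJet n m // (u.1, fun σ => u.2 (0, σ)) ∈ W}

theorem trunc_mem (k : ℕ) (u : InfOver W) : trunc k u.1 ∈ jetsOver k (W : Set (FibCoord n m)) :=
  u.2

/-- Extension by zero of `k`-jets over `W`. -/
def extendOver {k : ℕ} (u : JetCoord n m k) (hu : u ∈ jetsOver k (W : Set (FibCoord n m))) :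
    InfOver W :=
  ⟨extend u, by
    have h := hu
    rw [← trunc_extend u] at h
    exact h⟩

theorem trunc_extendOver {k : ℕ} (u : JetCoord n m k)
    (hu : u ∈ jetsOver k (W : Set (FibCoord n m))) : trunc k (extendOver u hu).1 = u :=
  trunc_extend u

/-- The function `F` on infinite jets over `W` is the pull-back of the smooth function `f` on
`k`-jets. -/
structure Represents (k : ℕ) (f : JetCoord n m k → ℝ) (F : InfOver W → ℝ) : Prop where
  smooth : ContDiffOn ℝ ∞ f (jetsOver k (W : Set (FibCoord n m)))
  eq : ∀ u, F u = f (trunc k u.1)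

theorem Represents.pull_back {k l : ℕ} (h : k ≤ l) {f : JetCoord n m k → ℝ} {F : InfOver W → ℝ}
    (hf : Represents k f F) : Represents l (f ∘ jetProj n m l k) F where
  smooth := hf.smooth.comp (jetProj n m l k).contDiff.contDiffOn
    fun _ hu => jetProj_mem_jetsOver.2 hu
  eq u := by rw [hf.eq, Function.comp_apply, jetProj_trunc h]

theorem Represents.differentiableAt {k : ℕ} {f : JetCoord n m k → ℝ} {F : InfOver W → ℝ}
    (hf : Represents k f F) (u : InfOver W) : DifferentiableAt ℝ f (trunc k u.1) :=
  (hf.smooth.contDiffAt ((isOpen_jetsOver k).mem_nhds (trunc_mem k u))).differentiableAt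
    (by simp)

/-- Every jet over `W` is a truncation of an infinite jet over `W`, so two representatives agree
after pull-back on an open set. The chain rule then makes the differential of a function of finite
order independent of the representative. -/
theorem Represents.fderiv_eq_of_le {k l : ℕ} (h : k ≤ l) {f : JetCoord n m k → ℝ}
    {g : JetCoord n m l → ℝ} {F : InfOver W → ℝ} (hf : Represents k f F) (hg : Represents l g F)
    (u : InfOver W) (w : InfJet n m) :
    fderiv ℝ g (trunc l u.1) (trunc l w) = fderiv ℝ f (trunc k u.1) (trunc k w) := by
  have h1 : g =ᶠ[nhds (trunc l u.1)] f ∘ jetProj n m l k := by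
    filter_upwards [(isOpen_jetsOver l).mem_nhds (trunc_mem l u)] with v hv
    have h2 := hg.eq (extendOver v hv)
    rw [(hf.pull_back h).eq, trunc_extendOver] at h2
    exact h2.symm
  have h3 := hf.differentiableAt u
  rw [← jetProj_trunc h] at h3
  rw [h1.fderiv_eq, fderiv_comp _ h3 (jetProj n m l k).differentiableAt,
    ContinuousLinearMap.fderiv, ContinuousLinearMap.comp_apply, jetProj_trunc h, jetProj_trunc h]

theorem Represents.fderiv_eq {k l : ℕ} {f : JetCoord n m k → ℝ}
    {g : JetCoord n m l → ℝ} {F : InfOver W → ℝ} (hf : Represents k f F) (hg : Represents l g F)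
    (u : InfOver W) (w : InfJet n m) :
    fderiv ℝ f (trunc k u.1) (trunc k w) = fderiv ℝ g (trunc l u.1) (trunc l w) := by
  rcases le_total k l with h | h
  · exact (hf.fderiv_eq_of_le h hg u w).symm
  · exact hg.fderiv_eq_of_le h hf u w

theorem Represents.add {k : ℕ} {f g : JetCoord n m k → ℝ} {F G : InfOver W → ℝ}
    (hf : Represents k f F) (hg : Represents k g G) :
    Represents k (fun u => f u + g u) (F + G) where
  smooth := hf.smooth.add hg.smooth
  eq u := by simp [hf.eq, hg.eq]

theorem Represents.mul {k : ℕ} {f g : JetCoord n m k → ℝ} {F G : InfOver W → ℝ}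
    (hf : Represents k f F) (hg : Represents k g G) :
    Represents k (fun u => f u * g u) (F * G) where
  smooth := hf.smooth.mul hg.smooth
  eq u := by simp [hf.eq, hg.eq]

theorem Represents.const (k : ℕ) (c : ℝ) :
    Represents k (fun _ => c) (fun _ : InfOver W => c) where
  smooth := contDiffOn_const
  eq _ := rfl

theorem Represents.smul {k : ℕ} {f : JetCoord n m k → ℝ} {F : InfOver W → ℝ}
    (hf : Represents k f F) (c : ℝ) : Represents k (fun u => c * f u) (c • F) where
  smooth := contDiffOn_const.mul hf.smooth
  eq u := by simp [hf.eq]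

variable (W) in
/-- The algebra of smooth functions of finite order on infinite jets over `W`. -/
def JetFun : Subalgebra ℝ (InfOver W → ℝ) where
  carrier := {F | ∃ k f, Represents k f F}
  mul_mem' := by
    rintro F G ⟨k, f, hf⟩ ⟨l, g, hg⟩
    exact ⟨_, _, (hf.pull_back (le_max_left k l)).mul (hg.pull_back (le_max_right k l))⟩
  add_mem' := by
    rintro F G ⟨k, f, hf⟩ ⟨l, g, hg⟩
    exact ⟨_, _, (hf.pull_back (le_max_left k l)).add (hg.pull_back (le_max_right k l))⟩
  algebraMap_mem' c := ⟨0, _, Represents.const 0 c⟩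

/-- The order of a representative. -/
def reprOrder (F : JetFun W) : ℕ := F.2.choose

/-- A representative. -/
def reprFun (F : JetFun W) : JetCoord n m (reprOrder F) → ℝ := F.2.choose_spec.choose

theorem represents_reprFun (F : JetFun W) : Represents (reprOrder F) (reprFun F) F.1 :=
  F.2.choose_spec.choose_spec

/-- The differential of a function of finite order. -/
def diffAt (F : JetFun W) (u : InfOver W) : InfJet n m →ₗ[ℝ] ℝ :=
  (fderiv ℝ (reprFun F) (trunc _ u.1)).toLinearMap ∘ₗ trunc _

theorem Represents.diffAt_eq {F : JetFun W} {k : ℕ} {f : JetCoord n m k → ℝ}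
    (hf : Represents k f F.1) (u : InfOver W) (w : InfJet n m) :
    diffAt F u w = fderiv ℝ f (trunc k u.1) (trunc k w) :=
  (represents_reprFun F).fderiv_eq hf u w

theorem diffAt_add (F G : JetFun W) (u : InfOver W) (w : InfJet n m) :
    diffAt (F + G) u w = diffAt F u w + diffAt G u w := by
  set l := max (reprOrder F) (reprOrder G)
  have hf := (represents_reprFun F).pull_back (le_max_left _ _ : _ ≤ l)
  have hg := (represents_reprFun G).pull_back (le_max_right _ _ : _ ≤ l)
  rw [hf.diffAt_eq, hg.diffAt_eq, Represents.diffAt_eq (F := F + G) (hf.add hg),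
    fderiv_fun_add (hf.differentiableAt u) (hg.differentiableAt u)]
  rfl

theorem diffAt_mul (F G : JetFun W) (u : InfOver W) (w : InfJet n m) :
    diffAt (F * G) u w = F.1 u * diffAt G u w + G.1 u * diffAt F u w := by
  set l := max (reprOrder F) (reprOrder G)
  have hf := (represents_reprFun F).pull_back (le_max_left _ _ : _ ≤ l)
  have hg := (represents_reprFun G).pull_back (le_max_right _ _ : _ ≤ l)
  rw [hf.diffAt_eq, hg.diffAt_eq, Represents.diffAt_eq (F := F * G) (hf.mul hg),
    fderiv_fun_mul (hf.differentiableAt u) (hg.differentiableAt u), hf.eq, hg.eq]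
  rfl

theorem diffAt_smul (c : ℝ) (F : JetFun W) (u : InfOver W) (w : InfJet n m) :
    diffAt (c • F) u w = c * diffAt F u w := by
  have hf := represents_reprFun F
  rw [hf.diffAt_eq, Represents.diffAt_eq (F := c • F) (hf.smul c),
    fderiv_const_mul (hf.differentiableAt u)]
  rfl

/-- The second differential of a function of finite order, in coordinates. -/
def hessAt (F : JetFun W) (u : InfOver W) (w w' : InfJet n m) : ℝ :=
  fderiv ℝ (fderiv ℝ (reprFun F)) (trunc _ u.1) (trunc _ w) (trunc _ w')

theorem hessAt_symm (F : JetFun W) (u : InfOver W) (w w' : InfJet n m) :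
    hessAt F u w w' = hessAt F u w' w := by
  have h := ((represents_reprFun F).smooth.contDiffAt
    ((isOpen_jetsOver _).mem_nhds (trunc_mem _ u))).isSymmSndFDerivAt
      (by simpa using WithTop.coe_le_coe.2 (le_top : (2 : ℕ∞) ≤ ⊤))
  exact h _ _

theorem Represents.contDiffOn_fderiv {k : ℕ} {f : JetCoord n m k → ℝ} {F : InfOver W → ℝ}
    (hf : Represents k f F) :
    ContDiffOn ℝ ∞ (fderiv ℝ f) (jetsOver k (W : Set (FibCoord n m))) :=
  hf.smooth.fderiv_of_isOpen (isOpen_jetsOver k) (by simp)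

theorem contDiffOn_totalDeriv {k : ℕ} {f : JetCoord n m k → ℝ} {F : InfOver W → ℝ}
    (hf : Represents k f F) (i : Fin n) :
    ContDiffOn ℝ ∞ (totalDeriv i f) (jetsOver (k + 1) (W : Set (FibCoord n m))) :=
  (hf.contDiffOn_fderiv.comp (jetProj n m (k + 1) k).contDiff.contDiffOn
    fun _ hu => jetProj_mem_jetsOver.2 hu).clm_apply (contDiff_totalVec i).contDiffOn

theorem Represents.totalDeriv {F : JetFun W} {k : ℕ} {f : JetCoord n m k → ℝ}
    (hf : Represents k f F.1) (i : Fin n) :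
    Represents (k + 1) (totalDeriv i f) (fun u : InfOver W => diffAt F u (totalInf i u.1)) where
  smooth := contDiffOn_totalDeriv hf i
  eq u := by
    rw [hf.diffAt_eq, FiberedJet.totalDeriv, jetProj_trunc (Nat.le_succ k), trunc_totalInf]

theorem Represents.partialDeriv {F : JetFun W} {k : ℕ} {f : JetCoord n m k → ℝ}
    (hf : Represents k f F.1) (p : Idx n m) :
    Represents k (fun u => fderiv ℝ f u (trunc k (coordInf p)))
      (fun u : InfOver W => diffAt F u (coordInf p)) where
  smooth := hf.contDiffOn_fderiv.clm_apply contDiffOn_const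
  eq u := hf.diffAt_eq u _

/-- The total derivative on functions of finite order. -/
def totalDer (i : Fin n) : Derivation ℝ (JetFun W) (JetFun W) :=
  Derivation.mk'
    { toFun := fun F => ⟨fun u => diffAt F u (totalInf i u.1), _, _,
        (represents_reprFun F).totalDeriv i⟩
      map_add' := fun F G => Subtype.ext (funext fun u => diffAt_add F G u _)
      map_smul' := fun c F => Subtype.ext (funext fun u => diffAt_smul c F u _) }
    fun F G => Subtype.ext (funext fun u => diffAt_mul F G u _)

theorem totalDer_apply (i : Fin n) (F : JetFun W) (u : InfOver W) :
    (totalDer i F).1 u = diffAt F u (totalInf i u.1) := rfl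

/-- The partial derivative along a fibre coordinate on functions of finite order. -/
def partialDer (p : Idx n m) (F : JetFun W) : JetFun W :=
  ⟨fun u => diffAt F u (coordInf p), _, _, (represents_reprFun F).partialDeriv p⟩

theorem partialDer_apply (p : Idx n m) (F : JetFun W) (u : InfOver W) :
    (partialDer p F).1 u = diffAt F u (coordInf p) := rfl

theorem Represents.partialDer_of_lt {F : JetFun W} {k : ℕ} {f : JetCoord n m k → ℝ}
    (hf : Represents k f F.1) {p : Idx n m} (h : k < ∑ i, p.1 i) : partialDer p F = 0 := by
  refine Subtype.ext (funext fun u => ?_)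
  rw [partialDer_apply, hf.diffAt_eq, trunc_coordInf_of_lt h, map_zero]
  rfl

theorem finite_idx_le (n m k : ℕ) : {p : Idx n m | ∑ i, p.1 i ≤ k}.Finite := by
  refine (Set.finite_range fun q : MultiIndex n k × Fin m => ((q.1.1, q.2) : Idx n m)).subset ?_
  intro p hp
  exact ⟨(⟨p.1, hp⟩, p.2), rfl⟩

/-- The vertical differential of functions of finite order. -/
def verticalDer : Derivation ℝ (JetFun W) (Idx n m →₀ JetFun W) :=
  Derivation.mk'
    { toFun := fun F => Finsupp.ofSupportFinite (fun p => partialDer p F)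
        ((finite_idx_le n m (reprOrder F)).subset fun p hp => by
          by_contra h
          exact hp ((represents_reprFun F).partialDer_of_lt (not_le.1 h)))
      map_add' := fun F G => Finsupp.ext fun p => Subtype.ext (funext fun u => diffAt_add F G u _)
      map_smul' := fun c F =>
        Finsupp.ext fun p => Subtype.ext (funext fun u => diffAt_smul c F u _) }
    fun F G => Finsupp.ext fun p => Subtype.ext (funext fun u => diffAt_mul F G u _)

theorem verticalDer_apply (F : JetFun W) (p : Idx n m) : verticalDer F p = partialDer p F := rfl

theorem fderiv_totalDeriv_apply {k : ℕ} {f : JetCoord n m k → ℝ} {i : Fin n}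
    {v : JetCoord n m (k + 1)} (hf : DifferentiableAt ℝ (fderiv ℝ f) (jetProj n m (k + 1) k v))
    (w : JetCoord n m (k + 1)) :
    fderiv ℝ (totalDeriv i f) v w =
      fderiv ℝ (fderiv ℝ f) (jetProj n m (k + 1) k v) (jetProj n m (k + 1) k w) (totalVec i v) +
        fderiv ℝ f (jetProj n m (k + 1) k v) (shift i w) := by
  have h1 : HasFDerivAt (fun v => fderiv ℝ f (jetProj n m (k + 1) k v)) _ v :=
    hf.hasFDerivAt.comp v (jetProj n m (k + 1) k).hasFDerivAt
  have h2 := h1.clm_apply (hasFDerivAt_totalVec i v)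
  have h3 := h2.fderiv
  unfold totalDeriv
  rw [h3]
  simp only [add_apply, ContinuousLinearMap.comp_apply,
    ContinuousLinearMap.flip_apply]
  exact add_comm _ _

/-- The first term differentiates the coefficients of `dF`, the second the vector field, whose
linear part is the shift. Commutation of total derivatives follows from the symmetry of the Hessian
together with `shiftInf_totalInf`. -/
theorem diffAt_totalDer (i : Fin n) (F : JetFun W) (u : InfOver W) (w : InfJet n m) :
    diffAt (totalDer i F) u w =
      hessAt F u w (totalInf i u.1) + diffAt F u (shiftInf i w) := by
  have hf := represents_reprFun F
  have h1 := (hf.contDiffOn_fderiv.contDiffAt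
    ((isOpen_jetsOver _).mem_nhds (trunc_mem _ u))).differentiableAt (by simp)
  rw [← jetProj_trunc (Nat.le_succ _)] at h1
  rw [Represents.diffAt_eq (F := totalDer i F) (hf.totalDeriv i), hf.diffAt_eq, hessAt,
    fderiv_totalDeriv_apply h1, jetProj_trunc (Nat.le_succ _), jetProj_trunc (Nat.le_succ _),
    trunc_totalInf, trunc_shiftInf]

theorem diffAt_partialDer (p : Idx n m) (F : JetFun W) (u : InfOver W) (w : InfJet n m) :
    diffAt (partialDer p F) u w = hessAt F u w (coordInf p) := by
  have hf := represents_reprFun F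
  rw [Represents.diffAt_eq (F := partialDer p F) (hf.partialDeriv p), hessAt]
  have h1 := ((hf.contDiffOn_fderiv.contDiffAt
    ((isOpen_jetsOver _).mem_nhds (trunc_mem _ u))).differentiableAt (by simp)).hasFDerivAt
  rw [(h1.clm_apply (hasFDerivAt_const _ _)).fderiv]
  simp

variable (W) in
/-- The variational algebra of functions of finite order on infinite jets over `W`. -/
def jetAlgebra : VariationalAlgebra n m (JetFun W) where
  D := totalDer
  dv := verticalDer
  D_comm i j F := Subtype.ext <| funext fun u => by
    rw [totalDer_apply, totalDer_apply, diffAt_totalDer, diffAt_totalDer, hessAt_symm,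
      shiftInf_totalInf]
  dv_D i F := Finsupp.ext fun p => Subtype.ext <| funext fun u => by
    have h1 : (lieTotal (totalDer i) i (verticalDer F) p).1 u =
        (totalDer i (partialDer p F)).1 u +
          (Finsupp.mapDomain (Idx.snoc i) (verticalDer F) p).1 u := rfl
    rw [h1, verticalDer_apply, partialDer_apply, totalDer_apply, diffAt_totalDer,
      diffAt_partialDer, hessAt_symm]
    congr 1
    -- The shift term is the partial derivative along the label with one `i` removed; it is absent
    -- when `i` does not occur in `p`.
    by_cases hp : p ∈ Set.range (Idx.snoc i)
    · obtain ⟨q, rfl⟩ := hp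
      rw [Finsupp.mapDomain_apply (snoc_injective i), shiftInf_coordInf_snoc, verticalDer_apply,
        partialDer_apply]
    · rw [Finsupp.mapDomain_of_notMem_range _ _ hp, shiftInf_coordInf_of_notMem i p hp, map_zero]
      rfl
  dv_symm F p q := Subtype.ext <| funext fun u => by
    simp only [verticalDer_apply, partialDer_apply, diffAt_partialDer]
    rw [hessAt_symm]

end JetFunctions

/-! ### Alternating maps in finite dimension -/

section Alternating

variable {E F : Type*} [NormedAddCommGroup E] [NormedSpace ℝ E]
  [NormedAddCommGroup F] [NormedSpace ℝ F]

/-- An alternating map in finite dimension is recovered linearly from its values on tuples of basis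
vectors. Regularity of forms can therefore be checked after evaluation on fixed vectors. -/
theorem exists_evaluation_leftInverse (F : Type*) [NormedAddCommGroup F] [NormedSpace ℝ F]
    [FiniteDimensional ℝ F] (q : ℕ) :
    ∃ (κ : Type) (_ : Fintype κ) (b : κ → Fin q → F) (g : (κ → ℝ) →L[ℝ] F [⋀^Fin q]→L[ℝ] ℝ),
      ∀ A : F [⋀^Fin q]→L[ℝ] ℝ, g (fun k => A (b k)) = A := by
  let e := Module.finBasis ℝ F
  let Φ : (F [⋀^Fin q]→L[ℝ] ℝ) →ₗ[ℝ] ((Fin q → Fin (Module.finrank ℝ F)) → ℝ) :=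
    { toFun := fun A k => A (fun j => e (k j))
      map_add' := fun _ _ => rfl
      map_smul' := fun _ _ => rfl }
  have hΦ : LinearMap.ker Φ = ⊥ := by
    refine LinearMap.ker_eq_bot'.2 fun A hA => ?_
    have h : A.toAlternatingMap = 0 := by
      refine e.ext_alternating fun v _ => ?_
      exact congrFun hA v
    ext v
    exact congrArg (fun B : F [⋀^Fin q]→ₗ[ℝ] ℝ => B v) h
  obtain ⟨g, hg⟩ := Φ.exists_leftInverse_of_injective hΦ
  refine ⟨_, inferInstance, fun k j => e (k j), LinearMap.toContinuousLinearMap g, fun A => ?_⟩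
  exact LinearMap.congr_fun hg A

theorem contDiffOn_alternating [FiniteDimensional ℝ F] {q : ℕ} {f : E → F [⋀^Fin q]→L[ℝ] ℝ} {s : Set E} {k : WithTop ℕ∞}
    (h : ∀ v, ContDiffOn ℝ k (fun u => f u v) s) : ContDiffOn ℝ k f s := by
  obtain ⟨κ, _, b, g, hg⟩ := exists_evaluation_leftInverse F q
  have h1 : f = fun u => g (fun k => f u (b k)) := funext fun u => (hg (f u)).symm
  rw [h1]
  exact g.contDiff.comp_contDiffOn (contDiffOn_pi.2 fun k => h (b k))

theorem differentiableAt_alternating [FiniteDimensional ℝ F] {q : ℕ} {f : E → F [⋀^Fin q]→L[ℝ] ℝ} {u : E}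
    (h : ∀ v, DifferentiableAt ℝ (fun u => f u v) u) : DifferentiableAt ℝ f u := by
  obtain ⟨κ, _, b, g, hg⟩ := exists_evaluation_leftInverse F q
  have h1 : f = fun u => g (fun k => f u (b k)) := funext fun u => (hg (f u)).symm
  rw [h1]
  exact g.differentiableAt.comp u (differentiableAt_pi.2 fun k => h (b k))

theorem contDiffOn_alternating_comp_apply {G : Type*} [NormedAddCommGroup G] [NormedSpace ℝ G]
    {q : ℕ} {f : E → F [⋀^Fin q]→L[ℝ] ℝ} {s : Set E} {k : WithTop ℕ∞} (hf : ContDiffOn ℝ k f s)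
    {g : Fin q → E → G →L[ℝ] F} (hg : ∀ j, ContDiffOn ℝ k (g j) s) (v : Fin q → G) :
    ContDiffOn ℝ k (fun u => f u (fun j => g j u (v j))) s := by
  have h1 : ContDiffOn ℝ k (fun u =>
      ContinuousMultilinearMap.compContinuousLinearMapContinuousMultilinear ℝ
        (fun _ : Fin q => G) (fun _ : Fin q => F) ℝ (fun j => g j u)) s :=
    (ContinuousMultilinearMap.contDiff _).comp_contDiffOn (contDiffOn_pi.2 hg)
  have h2 : ContDiffOn ℝ k (fun u => (f u).toContinuousMultilinearMap) s :=
    (ContinuousAlternatingMap.toContinuousMultilinearMapCLM ℝ :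
      (F [⋀^Fin q]→L[ℝ] ℝ) →L[ℝ] _).contDiff.comp_contDiffOn hf
  exact (ContinuousMultilinearMap.apply ℝ (fun _ : Fin q => G) ℝ v).contDiff.comp_contDiffOn
    (h1.clm_apply h2)

theorem alternating_update {q : ℕ} (A : F [⋀^Fin (q + 1)]→L[ℝ] ℝ) (v : Fin (q + 1) → F)
    (a : Fin (q + 1)) (x : F) :
    A (Function.update v a x) = (-1) ^ (a : ℕ) * A (Matrix.vecCons x (a.removeNth v)) := by
  have h := A.toAlternatingMap.map_insertNth a x (a.removeNth v)
  rw [Fin.insertNth_removeNth] at h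
  simpa using h

end Alternating

/-! ### Contact components -/

section Contact

variable {n m k q : ℕ}

/-- The standard volume form `dx^1 ∧ ⋯ ∧ dx^n` on jets. -/
def vol (n m k : ℕ) : (JetCoord n m k) [⋀^Fin n]→L[ℝ] ℝ :=
  ContinuousAlternatingMap.compContinuousLinearMap
    { (Matrix.detRowAlternating : (Fin n → ℝ) [⋀^Fin n]→ₗ[ℝ] ℝ) with
      cont := by
        change Continuous fun v : Fin n → Fin n → ℝ => Matrix.det v
        exact Continuous.matrix_det continuous_id }
    (ContinuousLinearMap.fst ℝ _ _)

theorem vol_apply (v : Fin n → JetCoord n m k) :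
    vol n m k v = Matrix.det fun i => (v i).1 := rfl

theorem vol_congr {l : ℕ} {v : Fin n → JetCoord n m k} {w : Fin n → JetCoord n m l}
    (h : ∀ i, (v i).1 = (w i).1) : vol n m k v = vol n m l w := by
  simp only [vol_apply, h]

theorem vol_frame {v : Fin n → JetCoord n m k} (h : ∀ i, (v i).1 = Pi.single i 1) :
    vol n m k v = 1 := by
  simp only [vol_apply, h]
  have : (fun i => Pi.single i 1 : Fin n → Fin n → ℝ) = (1 : Matrix (Fin n) (Fin n) ℝ) := by
    funext i j
    simp [Matrix.one_apply, Pi.single_apply, eq_comm]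
  rw [this, Matrix.det_one]

theorem vol_eq_zero {v : Fin n → JetCoord n m k} {i : Fin n} (h : (v i).1 = 0) :
    vol n m k v = 0 := by
  rw [vol_apply]
  exact Matrix.det_eq_zero_of_row_eq_zero i fun j => congrFun h j

/-- The vertical vector sits in slot `0`, so removing a later slot leaves it among the arguments. -/
theorem vol_removeNth_succ {v : Fin n → JetCoord n m k} {w : JetCoord n m k} (hw : w.1 = 0)
    (a : Fin n) : vol n m k (a.succ.removeNth (Matrix.vecCons w v)) = 0 := by
  cases n with
  | zero => exact a.elim0
  | succ n =>
    obtain ⟨j, hj⟩ := Fin.exists_succAbove_eq (Fin.succ_ne_zero a).symm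
    refine vol_eq_zero (i := j) ?_
    rw [Fin.removeNth_apply, hj]
    exact hw

theorem hor_apply (u v : JetCoord n m (k + 1)) : hor u v = ∑ i, v.1 i • totalVec i u := by
  simp [hor]

theorem hor_congr (u : JetCoord n m (k + 1)) {v w : JetCoord n m (k + 1)} (h : v.1 = w.1) :
    hor u v = hor u w := by
  rw [hor_apply, hor_apply, h]

theorem hor_of_vertical (u : JetCoord n m (k + 1)) {v : JetCoord n m (k + 1)} (h : v.1 = 0) :
    hor u v = 0 := by
  simp [hor_apply, h]

theorem hor_frame (u : JetCoord n m (k + 1)) {v : JetCoord n m (k + 1)} {i : Fin n}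
    (h : v.1 = Pi.single i 1) : hor u v = totalVec i u := by
  rw [hor_apply, h, Finset.sum_eq_single i]
  · simp
  · intro j _ hj
    simp [hj]
  · simp

theorem hor_fst (u v : JetCoord n m (k + 1)) : (hor u v).1 = v.1 := by
  rw [hor_apply]
  funext j
  simp only [Prod.fst_sum, Finset.sum_apply, totalVec, Prod.smul_fst, Pi.smul_apply, smul_eq_mul,
    Pi.single_apply, mul_ite, mul_one, mul_zero]
  simp

theorem con_of_vertical (u : JetCoord n m (k + 1)) {v : JetCoord n m (k + 1)} (h : v.1 = 0) :
    con u v = jetProj n m (k + 1) k v := by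
  rw [con, sub_apply, hor_of_vertical u h, sub_zero]

theorem con_fst (u v : JetCoord n m (k + 1)) : (con u v).1 = 0 := by
  rw [con, sub_apply, Prod.fst_sub, hor_fst]
  exact sub_self _

/-- The contact component of a tangent vector of infinite jets. -/
def conInf (u v : InfJet n m) : InfJet n m := (0, fun p => v.2 p - ∑ i, v.1 i * u.2 (p.snoc i))

theorem con_trunc (u v : InfJet n m) :
    con (trunc (k + 1) u) (trunc (k + 1) v) = trunc k (conInf u v) := by
  refine Prod.ext (con_fst _ _) ?_
  rw [con, sub_apply, jetProj_trunc (Nat.le_succ k), hor_apply]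
  funext I σ
  simp only [Prod.snd_sub, Prod.snd_sum, Pi.sub_apply, Finset.sum_apply, Prod.smul_snd,
    Pi.smul_apply, smul_eq_mul]
  rfl

theorem conInf_of_vertical (u : InfJet n m) {v : InfJet n m} (h : v.1 = 0) : conInf u v = v := by
  refine Prod.ext h.symm ?_
  funext p
  simp [conInf, h]

theorem conInf_totalInf (i : Fin n) (u : InfJet n m) : conInf u (totalInf i u) = 0 := by
  refine Prod.ext rfl ?_
  funext p
  simp [conInf, totalInf, Pi.single_apply]

theorem contactForm_trunc (I : MultiIndex n k) (σ : Fin m) (u v : InfJet n m) :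
    contactForm I σ (trunc (k + 1) u) (trunc (k + 1) v) = (conInf u v).2 (I.1, σ) := by
  have h : contactForm I σ (trunc (k + 1) u) (trunc (k + 1) v) =
      (con (trunc (k + 1) u) (trunc (k + 1) v)).2 I σ := rfl
  rw [h, con_trunc]
  rfl

theorem contactPart_apply (p : ℕ) (ρ : LocForm n m k q) (u : JetCoord n m (k + 1))
    (v : Fin q → JetCoord n m (k + 1)) :
    contactPart p ρ u v = ∑ S ∈ Finset.powersetCard p (Finset.univ : Finset (Fin q)),
      ρ (jetProj n m (k + 1) k u) (fun j => (if j ∈ S then con u else hor u) (v j)) := by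
  change (∑ S ∈ Finset.powersetCard p (Finset.univ : Finset (Fin q)),
      (ρ (jetProj n m (k + 1) k u)).toContinuousMultilinearMap.compContinuousLinearMap
        (fun j => if j ∈ S then con u else hor u)) v = _
  rw [sum_apply]
  rfl

theorem contactPart_zero_apply (ρ : LocForm n m k q) (u : JetCoord n m (k + 1))
    (v : Fin q → JetCoord n m (k + 1)) :
    contactPart 0 ρ u v = ρ (jetProj n m (k + 1) k u) (fun j => hor u (v j)) := by
  simp [contactPart_apply]

theorem contactPart_one_apply (ξ : LocForm n m k (q + 1)) (u : JetCoord n m (k + 1))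
    (v : Fin (q + 1) → JetCoord n m (k + 1)) :
    contactPart 1 ξ u v = ∑ a : Fin (q + 1), (-1) ^ (a : ℕ) * ξ (jetProj n m (k + 1) k u)
      (Matrix.vecCons (con u (v a)) (fun j => hor u (a.removeNth v j))) := by
  rw [contactPart_apply, Finset.powersetCard_one, Finset.sum_map]
  refine Finset.sum_congr rfl fun a _ => ?_
  have h1 : (fun j => (if j ∈ ({a} : Finset (Fin (q + 1))) then con u else hor u) (v j)) =
      Function.update (fun j => hor u (v j)) a (con u (v a)) := by
    funext j
    by_cases hj : j = a
    · subst hj; simp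
    · simp [hj]
  exact (congrArg _ h1).trans (alternating_update _ _ _ _)

/-- Evaluation of a form on horizontal vectors in terms of the total derivatives. -/
theorem apply_hor (A : (JetCoord n m k) [⋀^Fin n]→L[ℝ] ℝ) (u : JetCoord n m (k + 1))
    (v : Fin n → JetCoord n m (k + 1)) :
    A (fun j => hor u (v j)) = A (fun i => totalVec i u) * vol n m (k + 1) v := by
  let T : (Fin n → ℝ) →ₗ[ℝ] JetCoord n m k :=
    ∑ i, (LinearMap.proj i).smulRight (totalVec i u)
  have hT : ∀ x, T x = ∑ i, x i • totalVec i u := fun x => by simp [T]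
  have h := AlternatingMap.eq_smul_basis_det (Pi.basisFun ℝ (Fin n))
    (A.toAlternatingMap.compLinearMap T)
  have h1 := congrArg (fun B : (Fin n → ℝ) [⋀^Fin n]→ₗ[ℝ] ℝ => B fun j => (v j).1) h
  have h2 : (Pi.basisFun ℝ (Fin n)).det (fun j => (v j).1) = vol n m (k + 1) v := by
    rw [Pi.basisFun_det_apply]; rfl
  have h3 : ∀ i, T (Pi.basisFun ℝ (Fin n) i) = totalVec i u := fun i => by
    rw [hT, Finset.sum_eq_single i]
    · simp
    · intro j _ hj
      simp [hj]
    · simp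
  simp only [AlternatingMap.smul_apply, smul_eq_mul, h2, AlternatingMap.compLinearMap_apply] at h1
  simp only [h3] at h1
  simp only [hor_apply, ← hT]
  exact h1

/-- A horizontal form of top degree is its value on the total derivatives times the volume form;
this is how forms become elements of `JetFun`. -/
theorem contactPart_zero_top (ρ : LocForm n m k n) (u : JetCoord n m (k + 1)) :
    contactPart 0 ρ u =
      ρ (jetProj n m (k + 1) k u) (fun i => totalVec i u) • vol n m (k + 1) := by
  ext v
  rw [contactPart_zero_apply, apply_hor]
  rfl

theorem contactPart_one_top (ξ : LocForm n m k (n + 1)) (u : JetCoord n m (k + 1))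
    (v : Fin (n + 1) → JetCoord n m (k + 1)) :
    contactPart 1 ξ u v = ∑ a : Fin (n + 1), (-1) ^ (a : ℕ) *
      (ξ (jetProj n m (k + 1) k u) (Matrix.vecCons (con u (v a)) (fun i => totalVec i u)) *
        vol n m (k + 1) (a.removeNth v)) := by
  rw [contactPart_one_apply]
  refine Finset.sum_congr rfl fun a _ => ?_
  congr 1
  exact apply_hor ((ξ (jetProj n m (k + 1) k u)).curryLeft (con u (v a))) u (a.removeNth v)

/-- A `1`-contact component with a vertical first argument. -/
theorem contactPart_one_vecCons (ξ : LocForm n m k (q + 1)) (u : JetCoord n m (k + 1))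
    {w : JetCoord n m (k + 1)} (hw : w.1 = 0) (v : Fin q → JetCoord n m (k + 1)) :
    contactPart 1 ξ u (Matrix.vecCons w v) = ξ (jetProj n m (k + 1) k u)
      (Matrix.vecCons (jetProj n m (k + 1) k w) (fun j => hor u (v j))) := by
  rw [contactPart_one_apply, Fin.sum_univ_succ, Finset.sum_eq_zero, add_zero]
  · simp only [Matrix.cons_val_zero, con_of_vertical u hw, Fin.val_zero, pow_zero, one_mul]
    rfl
  · intro a _
    cases q with
    | zero => exact a.elim0
    | succ q =>
      obtain ⟨j, hj⟩ := Fin.exists_succAbove_eq (Fin.succ_ne_zero a).symm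
      refine mul_eq_zero_of_right _
        ((ξ (jetProj n m (k + 1) k u)).toAlternatingMap.map_coord_zero j.succ ?_)
      simp only [Matrix.cons_val_succ, Fin.removeNth_apply, hj, Matrix.cons_val_zero]
      exact hor_of_vertical u hw

theorem wedge_apply (α : JetCoord n m k →L[ℝ] ℝ) (β : (JetCoord n m k) [⋀^Fin q]→L[ℝ] ℝ)
    (v : Fin (q + 1) → JetCoord n m k) :
    wedge α β v = ∑ a : Fin (q + 1), (-1) ^ (a : ℕ) * (α (v a) * β (a.removeNth v)) := by
  rw [wedge, ContinuousAlternatingMap.alternatizeUncurryFin_apply]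
  simp

theorem wedge_vecCons_of_vertical (α : JetCoord n m k →L[ℝ] ℝ) (c : ℝ) {w : JetCoord n m k}
    (hw : w.1 = 0) (v : Fin n → JetCoord n m k) :
    wedge α (c • vol n m k) (Matrix.vecCons w v) = α w * c * vol n m k v := by
  rw [wedge_apply, Fin.sum_univ_succ, Finset.sum_eq_zero, add_zero]
  · simp only [Fin.val_zero, pow_zero, one_mul, Matrix.cons_val_zero, mul_assoc]
    rfl
  · intro a _
    simp only [ContinuousAlternatingMap.smul_apply, vol_removeNth_succ hw, smul_zero, mul_zero]

end Contact

/-! ### Horizontal forms of top degree and their Euler--Lagrange forms -/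

section Horizontal

variable {n m k : ℕ} {W : TopologicalSpace.Opens (FibCoord n m)}

theorem trunc_extend_eq_jetProj (l : ℕ) (u : JetCoord n m k) :
    trunc l (extend u) = jetProj n m k l u := by
  refine Prod.ext rfl ?_
  funext I σ
  by_cases h : ∑ i, I.1 i ≤ k <;> simp [trunc, extend, jetProj, h]

/-- A function on `k`-jets whose pull-back to infinite jets is smooth of finite order is smooth. -/
theorem represents_of_eq (F : JetFun W) {g : JetCoord n m k → ℝ}
    (h : ∀ u : InfOver W, F.1 u = g (trunc k u.1)) : Represents k g F.1 where
  eq := h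
  smooth := by
    have hf := represents_reprFun F
    -- The chosen representative may have order above `k`. Here `jetProj` fills in the missing
    -- coordinates by zero, so `g` is that representative evaluated on the extension by zero.
    refine ((hf.smooth.comp (jetProj n m k (reprOrder F)).contDiff.contDiffOn
      fun u hu => jetProj_mem_jetsOver.2 hu)).congr fun u hu => ?_
    have h1 := h (extendOver u hu)
    rw [trunc_extendOver, hf.eq] at h1
    rw [← h1, Function.comp_apply, ← trunc_extend_eq_jetProj]
    rfl

/-- The top degree form `L` is `F dx^1 ∧ ⋯ ∧ dx^n` on jets over `W`. -/
def RepresentsTop (L : LocForm n m k n) (F : JetFun W) : Prop :=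
  ∀ u : InfOver W, L (trunc k u.1) = F.1 u • vol n m k

/-- Lifts of the standard basis vectors. -/
def stdFrame (n m k : ℕ) (i : Fin n) : JetCoord n m k := (Pi.single i 1, 0)

namespace RepresentsTop

variable {L : LocForm n m k n} {F : JetFun W}

theorem represents (h : RepresentsTop L F) :
    Represents k (fun u => L u (stdFrame n m k)) F.1 :=
  represents_of_eq F fun u => by
    rw [h u, ContinuousAlternatingMap.smul_apply, vol_frame fun i => rfl, smul_eq_mul, mul_one]

theorem apply_eq (h : RepresentsTop L F) {u : JetCoord n m k}
    (hu : u ∈ jetsOver k (W : Set (FibCoord n m))) :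
    L u = L u (stdFrame n m k) • vol n m k := by
  have h1 := h (extendOver u hu)
  rw [trunc_extendOver] at h1
  rw [h1, ContinuousAlternatingMap.smul_apply, vol_frame fun i => rfl, smul_eq_mul, mul_one]

theorem eventuallyEq (h : RepresentsTop L F) (u : InfOver W) :
    L =ᶠ[nhds (trunc k u.1)] fun v => L v (stdFrame n m k) • vol n m k := by
  filter_upwards [(isOpen_jetsOver k).mem_nhds (trunc_mem k u)] with v hv
  exact h.apply_eq hv

/-- In `d(F vol)` every term in which the vertical vector stays inside the volume form vanishes;
only `dF(w)` survives. -/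
theorem extDeriv_apply (h : RepresentsTop L F) (u : InfOver W) {w : InfJet n m} (hw : w.1 = 0)
    {X : Fin n → JetCoord n m k} (hX : ∀ i, (X i).1 = Pi.single i 1) :
    extDeriv L (trunc k u.1) (Matrix.vecCons (trunc k w) X) = diffAt F u w := by
  have hd := h.represents.differentiableAt u
  rw [(h.eventuallyEq u).extDeriv_eq, _root_.extDeriv_apply (hd.smul_const _),
    Fin.sum_univ_succ, Finset.sum_eq_zero, add_zero]
  · simp only [ContinuousAlternatingMap.smul_apply, Fin.val_zero, pow_zero, one_smul,
      Matrix.cons_val_zero]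
    have h1 : vol n m k (Fin.removeNth 0 (Matrix.vecCons (trunc k w) X)) = 1 :=
      vol_frame fun i => hX i
    rw [h1, h.represents.diffAt_eq]
    simp
  · intro a _
    have h1 : vol n m k (a.succ.removeNth (Matrix.vecCons (trunc k w) X)) = 0 :=
      vol_removeNth_succ hw a
    simp [ContinuousAlternatingMap.smul_apply, h1]

theorem contract_contactPart_extDeriv (h : RepresentsTop L F) (I : MultiIndex n k) (σ : Fin m) :
    RepresentsTop (contract (coordVec I.lift σ) (contactPart 1 (extDeriv L)))
      (partialDer (I.1, σ) F) := by
  intro u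
  ext v
  have h1 : contract (coordVec I.lift σ) (contactPart 1 (extDeriv L)) (trunc (k + 1) u.1) v =
      contactPart 1 (extDeriv L) (trunc (k + 1) u.1)
        (Matrix.vecCons (trunc (k + 1) (coordInf (I.1, σ))) v) := by
    have : trunc (k + 1) (coordInf (I.1, σ)) = coordVec I.lift σ 0 := trunc_coordInf I.lift σ
    rw [this]
    rfl
  rw [h1, contactPart_one_vecCons _ _ rfl, jetProj_trunc (Nat.le_succ k),
    jetProj_trunc (Nat.le_succ k)]
  have h2 := apply_hor ((extDeriv L (trunc k u.1)).curryLeft (trunc k (coordInf (I.1, σ))))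
    (trunc (k + 1) u.1) v
  refine h2.trans ?_
  have h3 := h.extDeriv_apply u (w := coordInf (I.1, σ)) rfl
    (X := fun i => totalVec i (trunc (k + 1) u.1)) fun i => rfl
  rw [ContinuousAlternatingMap.smul_apply, partialDer_apply, ← h3]
  rfl

theorem formalD (h : RepresentsTop L F) (i : Fin n) :
    RepresentsTop (FiberedJet.formalD i L) (totalDer i F) := by
  intro u
  set v := trunc (k + 1) u.1 with hv
  have hproj : jetProj n m (k + 1) k v = trunc k u.1 := jetProj_trunc (Nat.le_succ k) u.1
  have hpath : HasDerivAt (fun t : ℝ => jetProj n m (k + 1) k v + t • totalVec i v)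
      (totalVec i v) 0 := by
    simpa using ((hasDerivAt_id (0 : ℝ)).smul_const (totalVec i v)).const_add
      (jetProj n m (k + 1) k v)
  -- `shift` has no base component, so the `dx^j` are unchanged by the deformation and the
  -- derivative falls on the coefficient alone.
  have hvol : ∀ t : ℝ, (vol n m k).compContinuousLinearMap
      (jetProj n m (k + 1) k + t • shift i) = vol n m (k + 1) := by
    intro t
    ext w
    refine vol_congr fun j => ?_
    simp [shift, jetProj]
  have hev : (fun t : ℝ => (L (jetProj n m (k + 1) k v + t • totalVec i v)).compContinuousLinearMap
      (jetProj n m (k + 1) k + t • shift i)) =ᶠ[nhds 0]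
      fun t => L (jetProj n m (k + 1) k v + t • totalVec i v) (stdFrame n m k) •
        vol n m (k + 1) := by
    have hmem : ∀ᶠ t : ℝ in nhds 0, jetProj n m (k + 1) k v + t • totalVec i v ∈
        jetsOver k (W : Set (FibCoord n m)) := by
      refine hpath.continuousAt.eventually ((isOpen_jetsOver k).mem_nhds ?_)
      change jetProj n m (k + 1) k v + (0 : ℝ) • totalVec i v ∈ _
      rw [zero_smul, add_zero, hproj]
      exact trunc_mem k u
    filter_upwards [hmem] with t ht
    ext w
    rw [h.apply_eq ht, ← hvol t]
    simp only [ContinuousAlternatingMap.compContinuousLinearMap_apply,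
      ContinuousAlternatingMap.smul_apply]
    rw [vol_frame (v := stdFrame n m k) fun i => rfl]
    simp
  have hd := h.represents.differentiableAt u
  have hcomp : HasDerivAt (fun t : ℝ =>
      L (jetProj n m (k + 1) k v + t • totalVec i v) (stdFrame n m k))
      (fderiv ℝ (fun w => L w (stdFrame n m k)) (trunc k u.1) (totalVec i v)) 0 := by
    have h1 : jetProj n m (k + 1) k v + (0 : ℝ) • totalVec i v = trunc k u.1 := by
      rw [zero_smul, add_zero, hproj]
    have h2 := hd.hasFDerivAt
    rw [← h1] at h2 ⊢
    exact h2.comp_hasDerivAt (0 : ℝ) hpath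
  have hsmul := hcomp.smul_const (vol n m (k + 1))
  rw [FiberedJet.formalD, hev.deriv_eq, totalDer_apply, h.represents.diffAt_eq, trunc_totalInf]
  exact hsmul.deriv

theorem formalDs (h : RepresentsTop L F) (J : List (Fin n)) :
    RepresentsTop (FiberedJet.formalDs J L) ((jetAlgebra W).iter J F) := by
  induction J with
  | nil => exact h
  | cons i J ih =>
    rw [VariationalAlgebra.iter_cons]
    exact ih.formalD i

end RepresentsTop

theorem Represents.totalDerivs {f : JetCoord n m k → ℝ} {F : JetFun W} (h : Represents k f F.1)
    (J : List (Fin n)) :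
    Represents (k + J.length) (totalDerivs J f) ((jetAlgebra W).iter J F).1 := by
  induction J with
  | nil => exact h
  | cons i J ih =>
    rw [VariationalAlgebra.iter_cons]
    exact Represents.totalDeriv ih i

theorem length_tuple (I : MultiIndex n k) : I.tuple.length ≤ k :=
  (length_tupleOf I.1).trans_le I.2

/-- A finitely supported family as a sum over multi-indices of bounded length. -/
theorem eq_sum_single {A : Type*} [AddCommMonoid A] (μ : Idx n m →₀ A)
    (hμ : ∀ p : Idx n m, k < ∑ i, p.1 i → μ p = 0) :
    μ = ∑ I : MultiIndex n k, ∑ σ : Fin m, Finsupp.single (I.1, σ) (μ (I.1, σ)) := by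
  ext ⟨J, τ⟩
  simp only [Finsupp.finsetSum_apply]
  by_cases hJ : ∑ i, J i ≤ k
  · rw [Finset.sum_eq_single ⟨J, hJ⟩, Finset.sum_eq_single τ]
    · simp
    · intro σ _ hσ
      simp [hσ]
    · simp
    · intro I _ hI
      refine Finset.sum_eq_zero fun σ _ => ?_
      rw [Finsupp.single_apply, if_neg]
      intro h
      exact hI (Subtype.ext (congrArg Prod.fst h))
    · simp
  · rw [hμ _ (not_le.1 hJ), Finset.sum_eq_zero]
    intro I _
    refine Finset.sum_eq_zero fun σ _ => ?_
    rw [Finsupp.single_apply, if_neg]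
    intro h
    have h1 : I.1 = J := congrArg Prod.fst h
    exact hJ (h1 ▸ I.2)

theorem Represents.euler_eq {f : JetCoord n m k → ℝ} {F : JetFun W} (h : Represents k f F.1)
    (σ : Fin m) : (jetAlgebra W).euler σ F =
      ∑ I : MultiIndex n k, (-1 : ℝ) ^ I.len • (jetAlgebra W).DI I.1 (partialDer (I.1, σ) F) := by
  rw [VariationalAlgebra.euler_apply,
    eq_sum_single (k := k) ((jetAlgebra W).dv F) fun p hp => h.partialDer_of_lt hp]
  rw [map_sum]
  refine Finset.sum_congr rfl fun I _ => ?_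
  rw [map_sum, Finset.sum_eq_single σ]
  · rw [VariationalAlgebra.interior_single, if_pos rfl]
    rfl
  · intro τ _ hτ
    rw [VariationalAlgebra.interior_single, if_neg hτ]
  · simp

variable {L : LocForm n m k n} {F : JetFun W}

theorem RepresentsTop.interiorEuler_eq (h : RepresentsTop L F) (u : InfOver W) :
    interiorEuler (extDeriv L) (trunc (2 * k + 1) u.1) =
      ∑ σ, wedge (contactForm (MultiIndex.zero n (2 * k)) σ (trunc (2 * k + 1) u.1))
        (((jetAlgebra W).euler σ F).1 u • vol n m (2 * k + 1)) := by
  rw [interiorEuler]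
  refine Finset.sum_congr rfl fun σ _ => ?_
  congr 1
  have h1 : ∀ I : MultiIndex n k, pull (2 * k + 1) (FiberedJet.formalDs I.tuple
      (contract (coordVec I.lift σ) (contactPart 1 (extDeriv L)))) (trunc (2 * k + 1) u.1) =
        ((jetAlgebra W).DI I.1 (partialDer (I.1, σ) F)).1 u • vol n m (2 * k + 1) := by
    intro I
    have h2 := (h.contract_contactPart_extDeriv I σ).formalDs I.tuple u
    have h3 := length_tuple I
    -- The first contact component raises the order to `k + 1` and `d_I` adds `|I| ≤ k`, which fits
    -- exactly into the order `2k + 1` of the Euler–Lagrange form.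
    have h4 : k + 1 + I.tuple.length ≤ 2 * k + 1 := by omega
    rw [pull, jetProj_trunc h4, h2]
    ext w
    rfl
  simp only [h1, h.represents.euler_eq σ]
  ext w
  have h5 : (∑ I : MultiIndex n k, (-1 : ℝ) ^ I.len •
      (jetAlgebra W).DI I.1 (partialDer (I.1, σ) F)).1 u =
        ∑ I : MultiIndex n k, (-1 : ℝ) ^ I.len *
          ((jetAlgebra W).DI I.1 (partialDer (I.1, σ) F)).1 u := by
    rw [AddSubmonoidClass.coe_finsetSum, Finset.sum_apply]
    rfl
  rw [h5, ContinuousAlternatingMap.sum_apply, ContinuousAlternatingMap.smul_apply, smul_eq_mul,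
    Finset.sum_mul]
  refine Finset.sum_congr rfl fun I _ => ?_
  simp [mul_assoc]

/-- The components `ψ^σ`, as functions on `0`-jets. -/
def fibreFun (ψ : FibCoord n m → Fin m → ℝ) (σ : Fin m) (w : JetCoord n m 0) : ℝ := ψ (toFib w) σ

/-- The prolongation on infinite jets. -/
def prolongInf (Ψ : Fin m → JetFun W) (u : InfOver W) : InfJet n m :=
  (0, fun p => ((jetAlgebra W).DI p.1 (Ψ p.2)).1 u)

theorem represents_prolong {ψ : FibCoord n m → Fin m → ℝ} {Ψ : Fin m → JetFun W}
    (hψ : ∀ σ, Represents 0 (fibreFun ψ σ) (Ψ σ).1) (l : ℕ) (I : MultiIndex n l) (σ : Fin m) :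
    Represents l (fun u => (prolong l ψ u).2 I σ) ((jetAlgebra W).DI I.1 (Ψ σ)).1 :=
  ((hψ σ).totalDerivs I.tuple).pull_back (by have := length_tuple I; omega)

theorem prolong_trunc {ψ : FibCoord n m → Fin m → ℝ} {Ψ : Fin m → JetFun W}
    (hψ : ∀ σ, Represents 0 (fibreFun ψ σ) (Ψ σ).1) (l : ℕ) (u : InfOver W) :
    prolong l ψ (trunc l u.1) = trunc l (prolongInf Ψ u) := by
  refine Prod.ext rfl ?_
  funext I σ
  exact ((represents_prolong hψ l I σ).eq u).symm

theorem RepresentsTop.contractEL (h : RepresentsTop L F) {ψ : FibCoord n m → Fin m → ℝ}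
    {Ψ : Fin m → JetFun W} (hψ : ∀ σ, Represents 0 (fibreFun ψ σ) (Ψ σ).1) :
    RepresentsTop (contractEL ψ L) (∑ σ, Ψ σ * (jetAlgebra W).euler σ F) := by
  intro u
  ext v
  have h1 : FiberedJet.contractEL ψ L (trunc (2 * k + 1) u.1) v =
      interiorEuler (extDeriv L) (trunc (2 * k + 1) u.1)
        (Matrix.vecCons (prolong (2 * k + 1) ψ (trunc (2 * k + 1) u.1)) v) := rfl
  have h2 : (∑ σ, Ψ σ * (jetAlgebra W).euler σ F).1 u =
      ∑ σ, (Ψ σ).1 u * ((jetAlgebra W).euler σ F).1 u := by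
    rw [AddSubmonoidClass.coe_finsetSum, Finset.sum_apply]
    rfl
  rw [h1, h.interiorEuler_eq, ContinuousAlternatingMap.sum_apply,
    ContinuousAlternatingMap.smul_apply, smul_eq_mul, h2, Finset.sum_mul]
  refine Finset.sum_congr rfl fun σ _ => ?_
  rw [wedge_vecCons_of_vertical _ _ rfl, prolong_trunc hψ, contactForm_trunc,
    conInf_of_vertical _ rfl]
  have h3 : (prolongInf Ψ u).2 ((MultiIndex.zero n (2 * k)).1, σ) = (Ψ σ).1 u := by
    change ((jetAlgebra W).DI 0 (Ψ σ)).1 u = _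
    rw [VariationalAlgebra.DI_zero]
  rw [h3]

end Horizontal

/-! ### Vertical pairings -/

section Pairing

variable {n m k : ℕ} {W : TopologicalSpace.Opens (FibCoord n m)}

variable (W) in
/-- Pairing of formal contact forms with a constant vertical vector. -/
def verticalPairing (w : InfJet n m) : (Idx n m →₀ JetFun W) →ₗ[JetFun W] JetFun W :=
  Finsupp.linearCombination (JetFun W) fun p => algebraMap ℝ (JetFun W) (w.2 p)

theorem verticalPairing_single (w : InfJet n m) (p : Idx n m) (a : JetFun W) (u : InfOver W) :
    (verticalPairing W w (Finsupp.single p a)).1 u = a.1 u * w.2 p := by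
  rw [verticalPairing, Finsupp.linearCombination_single]
  rfl

theorem coe_sum_apply {ι : Type*} (s : Finset ι) (F : ι → JetFun W) (u : InfOver W) :
    (∑ i ∈ s, F i).1 u = ∑ i ∈ s, (F i).1 u := by
  rw [AddSubmonoidClass.coe_finsetSum, Finset.sum_apply]

theorem verticalPairing_eq_sum (w : InfJet n m) (μ : Idx n m →₀ JetFun W)
    (hμ : ∀ p : Idx n m, k < ∑ i, p.1 i → μ p = 0) (u : InfOver W) :
    (verticalPairing W w μ).1 u =
      ∑ I : MultiIndex n k, ∑ σ : Fin m, (μ (I.1, σ)).1 u * w.2 (I.1, σ) := by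
  conv_lhs => rw [eq_sum_single μ hμ]
  simp only [map_sum, coe_sum_apply, verticalPairing_single]

theorem trunc_eq_sum_coordInf {w : InfJet n m} (hw : w.1 = 0) :
    trunc k w = ∑ I : MultiIndex n k, ∑ σ : Fin m, w.2 (I.1, σ) • trunc k (coordInf (I.1, σ)) := by
  have h0 : ∀ p : Idx n m, (trunc k (coordInf p)).1 = 0 := fun _ => rfl
  refine Prod.ext ?_ ?_
  · simp only [Prod.fst_sum, Prod.smul_fst, h0, smul_zero, Finset.sum_const_zero]
    exact hw
  · funext J τ
    simp only [Prod.snd_sum, Prod.smul_snd, Finset.sum_apply, Pi.smul_apply, smul_eq_mul,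
      trunc_coordInf]
    rw [Finset.sum_eq_single J, Finset.sum_eq_single τ]
    · simp [coordVec, trunc]
    · intro σ _ hσ
      simp [coordVec, hσ.symm]
    · simp
    · intro I _ hI
      simp [coordVec, hI.symm]
    · simp

theorem diffAt_eq_verticalPairing (F : JetFun W) (u : InfOver W) {w : InfJet n m}
    (hw : w.1 = 0) : diffAt F u w = (verticalPairing W w ((jetAlgebra W).dv F)).1 u := by
  have hf := represents_reprFun F
  rw [verticalPairing_eq_sum w _ (fun p hp => hf.partialDer_of_lt hp) u, hf.diffAt_eq,
    trunc_eq_sum_coordInf hw]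
  simp only [map_sum, map_smul]
  refine Finset.sum_congr rfl fun I _ => Finset.sum_congr rfl fun σ _ => ?_
  change _ = diffAt F u _ * _
  rw [hf.diffAt_eq, smul_eq_mul, mul_comm]

theorem contraction_apply (Ψ : Fin m → JetFun W) (μ : Idx n m →₀ JetFun W) (u : InfOver W) :
    ((jetAlgebra W).contraction Ψ μ).1 u = (verticalPairing W (prolongInf Ψ u) μ).1 u := by
  induction μ using Finsupp.induction_linear with
  | zero => simp
  | add f g hf hg =>
    rw [map_add, map_add]
    exact congrArg₂ (· + ·) hf hg
  | single p a =>
    rw [verticalPairing_single, VariationalAlgebra.contraction_single]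
    rfl

theorem evol_eq_diffAt (Ψ : Fin m → JetFun W) (F : JetFun W) (u : InfOver W) :
    ((jetAlgebra W).evol Ψ F).1 u = diffAt F u (prolongInf Ψ u) := by
  rw [VariationalAlgebra.evol_apply, contraction_apply, diffAt_eq_verticalPairing _ _ rfl]

theorem shiftInf_prolongInf (Ψ : Fin m → JetFun W) (i : Fin n) (u : InfOver W) :
    shiftInf i (prolongInf Ψ u) =
      (0, fun p => diffAt ((jetAlgebra W).DI p.1 (Ψ p.2)) u (totalInf i u.1)) := by
  refine Prod.ext rfl ?_
  funext p
  change ((jetAlgebra W).DI (p.1 + Pi.single i 1) (Ψ p.2)).1 u = _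
  rw [VariationalAlgebra.DI_snoc]
  rfl

/-- Along the total derivatives the prolongation varies by its own shift, because its `I i`
component is `d_i` of its `I` component. This is the infinitesimal form of preserving the contact
structure. -/
theorem hasFDerivAt_prolong {ψ : FibCoord n m → Fin m → ℝ} {Ψ : Fin m → JetFun W}
    (hψ : ∀ σ, Represents 0 (fibreFun ψ σ) (Ψ σ).1) (u : InfOver W) :
    ∃ P : JetCoord n m k →L[ℝ] JetCoord n m k, HasFDerivAt (prolong k ψ) P (trunc k u.1) ∧
      ∀ i, P (trunc k (totalInf i u.1)) = trunc k (shiftInf i (prolongInf Ψ u)) := by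
  have h1 : HasFDerivAt (fun v => (prolong k ψ v).2) _ (trunc k u.1) :=
    hasFDerivAt_pi.2 fun I : MultiIndex n k => hasFDerivAt_pi.2 fun σ : Fin m =>
      ((represents_prolong hψ k I σ).differentiableAt u).hasFDerivAt
  refine ⟨_, (hasFDerivAt_const (0 : Fin n → ℝ) _).prodMk h1, fun i => ?_⟩
  rw [shiftInf_prolongInf]
  refine Prod.ext rfl ?_
  funext I σ
  exact ((represents_prolong hψ k I σ).diffAt_eq u _).symm

end Pairing

/-! ### The horizontal differential of Noether currents -/

section HorizontalDifferential

variable {n m k q : ℕ}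

theorem contDiff_hor : ContDiff ℝ ∞ (hor (n := n) (m := m) (k := k)) := by
  unfold hor
  exact ContDiff.sum fun i _ => contDiff_const.smulRight (contDiff_totalVec i)

theorem contDiff_con : ContDiff ℝ ∞ (con (n := n) (m := m) (k := k)) :=
  contDiff_const.sub contDiff_hor

theorem contDiffOn_contactPart {W : Set (FibCoord n m)} {ρ : LocForm n m k q}
    (hρ : ContDiffOn ℝ ∞ ρ (jetsOver k W)) (p : ℕ) :
    ContDiffOn ℝ ∞ (contactPart p ρ) (jetsOver (k + 1) W) := by
  refine contDiffOn_alternating fun v => ?_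
  simp only [contactPart_apply]
  refine ContDiffOn.sum fun S _ => ?_
  have h1 : ContDiffOn ℝ ∞ (fun u => ρ (jetProj n m (k + 1) k u)) (jetsOver (k + 1) W) :=
    hρ.comp (jetProj n m (k + 1) k).contDiff.contDiffOn fun u hu => jetProj_mem_jetsOver.2 hu
  have h2 := contDiffOn_alternating_comp_apply h1
    (g := fun j u => if j ∈ S then con u else hor u) (fun j => by
      by_cases hj : j ∈ S
      · simpa only [hj, if_true] using contDiff_con.contDiffOn
      · simpa only [hj, if_false] using contDiff_hor.contDiffOn) v
  exact h2

theorem contactPart_one_totalVec (R : LocForm n m k (q + 1)) (v : JetCoord n m (k + 2))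
    (f : Fin (q + 1) → Fin n) :
    contactPart 1 R (jetProj n m (k + 2) (k + 1) v) (fun j => totalVec (f j) v) = 0 := by
  rw [contactPart_one_apply, Finset.sum_eq_zero]
  intro a _
  have h1 : con (jetProj n m (k + 2) (k + 1) v) (totalVec (f a) v) = 0 := by
    have h2 : totalVec (f a) v = trunc (k + 1) (totalInf (f a) (extend v)) := by
      rw [trunc_totalInf]
      exact congrArg _ (trunc_extend v).symm
    rw [h2, ← trunc_extend_of_le (Nat.le_succ (k + 1)), con_trunc, conInf_totalInf, map_zero]
  refine mul_eq_zero_of_right _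
    ((R (jetProj n m (k + 1) k (jetProj n m (k + 2) (k + 1) v))).toAlternatingMap.map_coord_zero
      0 ?_)
  exact h1

/-- The exterior derivative of a form without horizontal part, contracted with a vertical vector
and evaluated on total derivatives. -/
theorem extDeriv_of_horizontal_eq_zero {W : TopologicalSpace.Opens (FibCoord (n + 1) m)}
    {α : LocForm (n + 1) m k (n + 1)} (u : InfOver W) (hα : DifferentiableAt ℝ α (trunc k u.1))
    (h0 : ∀ v : JetCoord (n + 1) m (k + 1),
      α (jetProj (n + 1) m (k + 1) k v) (fun i => totalVec i v) = 0)
    {w : InfJet (n + 1) m} {T : Fin (n + 1) → JetCoord (n + 1) m k}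
    (hT : ∀ i, T i = trunc k (totalInf i u.1)) :
    extDeriv α (trunc k u.1) (Matrix.vecCons (trunc k w) T) =
      -∑ i : Fin (n + 1), (-1) ^ (i : ℕ) *
        (α (trunc k u.1) (Matrix.vecCons (trunc k (shiftInf i w)) (i.removeNth T)) +
          fderiv ℝ (fun x => α x (Matrix.vecCons (trunc k w) (i.removeNth T))) (trunc k u.1)
            (T i)) := by
  have hproj : ∀ v, jetProj (n + 1) m (k + 1) k (trunc (k + 1) v) = trunc k v :=
    jetProj_trunc (Nat.le_succ k)
  -- `α(d_0, …, d_n)` vanishes identically on `(k+1)`-jets. Differentiating this along `w`, where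
  -- `d_i` varies by `shift i w`, expresses the derivative of `α` along `w` with frozen arguments.
  have h1 : fderiv ℝ (fun x => α x T) (trunc k u.1) (trunc k w) =
      -∑ i : Fin (n + 1), (-1) ^ (i : ℕ) *
        α (trunc k u.1) (Matrix.vecCons (trunc k (shiftInf i w)) (i.removeNth T)) := by
    have hα' : DifferentiableAt ℝ α (jetProj (n + 1) m (k + 1) k (trunc (k + 1) u.1)) := by
      rwa [hproj]
    have h2 := fderiv_continuousAlternatingMap_apply_apply
      (f := fun v => α (jetProj (n + 1) m (k + 1) k v))
      (g := fun i v => totalVec i v) (x := trunc (k + 1) u.1)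
      (hα'.comp _ (jetProj (n + 1) m (k + 1) k).differentiableAt)
      (fun i => (hasFDerivAt_totalVec i _).differentiableAt) (trunc (k + 1) w)
    have h3 : (fun v => α (jetProj (n + 1) m (k + 1) k v) (fun i => totalVec i v)) =
        fun _ => (0 : ℝ) := funext h0
    have hT' : (fun i => totalVec i (trunc (k + 1) u.1)) = T := funext fun i => (hT i).symm
    rw [h3, hT'] at h2
    have h4 : fderiv ℝ (fun v => α (jetProj (n + 1) m (k + 1) k v)) (trunc (k + 1) u.1)
        (trunc (k + 1) w) = fderiv ℝ α (trunc k u.1) (trunc k w) := by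
      have h5 := fderiv_comp (trunc (k + 1) u.1) hα'
        (jetProj (n + 1) m (k + 1) k).differentiableAt
      rw [ContinuousLinearMap.fderiv, hproj] at h5
      have h6 := congrArg (fun A => A (trunc (k + 1) w)) h5
      rw [ContinuousLinearMap.comp_apply, hproj] at h6
      exact h6
    have h7 : fderiv ℝ (fun x => α x T) (trunc k u.1) (trunc k w) =
        fderiv ℝ α (trunc k u.1) (trunc k w) T := by
      have h8 := fderiv_continuousAlternatingMap_apply_apply hα
        (g := fun i _ => T i) (fun i => differentiableAt_const _) (trunc k w)
      rw [h8, add_eq_left]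
      refine Finset.sum_eq_zero fun i _ => ?_
      refine (α (trunc k u.1)).toAlternatingMap.map_coord_zero i ?_
      simp
    rw [h4, ← h7] at h2
    simp only [fderiv_fun_const, Pi.zero_apply, zero_apply,
      (hasFDerivAt_totalVec _ _).fderiv, ← trunc_shiftInf, hproj, alternating_update] at h2
    linarith
  have h2 : ∀ i : Fin (n + 1), i.succ.removeNth (Matrix.vecCons (trunc k w) T) =
      Matrix.vecCons (trunc k w) (i.removeNth T) := by
    intro i
    funext j
    refine Fin.cases ?_ (fun j => ?_) j
    · simp [Fin.removeNth_apply]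
    · simp [Fin.removeNth_apply]
  rw [extDeriv_apply hα, Fin.sum_univ_succ]
  simp only [h2, Fin.val_succ, pow_succ, Matrix.cons_val_zero, Matrix.cons_val_succ, Fin.val_zero,
    pow_zero, one_smul, mul_add, Finset.sum_add_distrib]
  have h3 : Fin.removeNth 0 (Matrix.vecCons (trunc k w) T) = T := by
    funext j
    simp [Fin.removeNth_apply]
  rw [h3, h1, neg_add, add_left_cancel_iff, ← Finset.sum_neg_distrib]
  exact Finset.sum_congr rfl fun i _ => by ring

theorem hasFDerivAt_vecCons {E F : Type*} [NormedAddCommGroup E] [NormedSpace ℝ E]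
    [NormedAddCommGroup F] [NormedSpace ℝ F] {α : E → F [⋀^Fin (q + 1)]→L[ℝ] ℝ} {u : E}
    (hα : DifferentiableAt ℝ α u) {P : E → F} {P' : E →L[ℝ] F} (hP : HasFDerivAt P P' u)
    (c : Fin q → F) :
    HasFDerivAt (fun x => α x (Matrix.vecCons (P x) c))
      (fderiv ℝ (fun x => α x (Matrix.vecCons (P u) c)) u +
        ((α u).toContinuousLinearMap (Matrix.vecCons (P u) c) 0).comp P') u := by
  have h1 : ∀ j : Fin (q + 1), HasFDerivAt (fun x => (Matrix.vecCons (P x) c : Fin (q + 1) → F) j)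
      (Fin.cases P' (fun _ => 0) j : E →L[ℝ] F) u := by
    intro j
    refine Fin.cases ?_ (fun j => ?_) j
    · exact hP
    · exact hasFDerivAt_const _ _
  have h2 := hα.hasFDerivAt.continuousAlternatingMap_apply h1
  have h3 := hα.hasFDerivAt.continuousAlternatingMap_apply
    (g := fun j _ => (Matrix.vecCons (P u) c : Fin (q + 1) → F) j)
    (fun j => hasFDerivAt_const _ _)
  refine h2.congr_fderiv ?_
  rw [h3.fderiv, Fin.sum_univ_succ]
  simp

theorem contactPart_zero_of_base {ε : LocForm n m k q}
    (hε : ∀ u x y, (∀ j, (x j).1 = (y j).1) → ε u x = ε u y) :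
    contactPart 0 ε = pull (k + 1) ε := by
  funext u
  ext v
  rw [contactPart_zero_apply]
  exact hε _ _ _ fun j => hor_fst u (v j)

/-- A contact argument has zero base component, so it can be replaced by `0` without changing the
value. -/
theorem contactPart_pos_of_base {ε : LocForm n m k q}
    (hε : ∀ u x y, (∀ j, (x j).1 = (y j).1) → ε u x = ε u y) {l : ℕ} (hl : l ≠ 0) :
    contactPart l ε = fun _ => 0 := by
  funext u
  ext v
  rw [contactPart_apply, Finset.sum_eq_zero]
  · rfl
  intro S hS
  obtain ⟨j, hj⟩ : S.Nonempty := by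
    rw [← Finset.card_pos, (Finset.mem_powersetCard.1 hS).2]
    exact Nat.pos_of_ne_zero hl
  rw [hε _ _ (Function.update (fun j => (if j ∈ S then con u else hor u) (v j)) j 0)]
  · exact (ε (jetProj n m (k + 1) k u)).toAlternatingMap.map_coord_zero j (by simp)
  · intro i
    by_cases hi : i = j
    · subst hi
      simp [hj, con_fst]
    · simp [hi]

/-- The horizontal differential of a form that only depends on the base components of its
arguments. -/
theorem dH_of_base {W : TopologicalSpace.Opens (FibCoord (n + 1) m)}
    {ε : LocForm (n + 1) m k n}
    (hε : ∀ u x y, (∀ j, (x j).1 = (y j).1) → ε u x = ε u y) (u : InfOver W)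
    (hd : DifferentiableAt ℝ ε (trunc k u.1)) :
    dH ε (trunc (k + 2) u.1) =
      extDeriv ε (trunc k u.1) (fun i => trunc k (totalInf i u.1)) • vol (n + 1) m (k + 2) := by
  have hproj : jetProj (n + 1) m (k + 1) k (trunc (k + 1) u.1) = trunc k u.1 :=
    jetProj_trunc (Nat.le_succ k) u.1
  have hproj' : jetProj (n + 1) m (k + 1 + 1) (k + 1) (trunc (k + 1 + 1) u.1) =
    trunc (k + 1) u.1 := jetProj_trunc (Nat.le_succ (k + 1)) u.1
  rw [dH, Finset.sum_eq_single 0]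
  · rw [contactPart_zero_of_base hε, contactPart_zero_top, hproj']
    congr 1
    have h1 : pull (k + 1) ε = fun x => (ε (jetProj (n + 1) m (k + 1) k x)).compContinuousLinearMap
        (fderiv ℝ (jetProj (n + 1) m (k + 1) k) x) := by
      funext x
      rw [ContinuousLinearMap.fderiv]
      rfl
    rw [h1, extDeriv_pullback (r := ∞) (by rwa [hproj])
      (jetProj (n + 1) m (k + 1) k).contDiff.contDiffAt
      (by simpa using WithTop.coe_le_coe.2 (le_top : (2 : ℕ∞) ≤ ⊤)), hproj,
      ContinuousLinearMap.fderiv, ContinuousAlternatingMap.compContinuousLinearMap_apply]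
    congr 1
    funext i
    exact jetProj_trunc (Nat.le_succ k) (totalInf i u.1)
  · intro l _ hl
    have h1 : extDeriv (contactPart l ε) = fun _ => 0 := by
      funext x
      rw [contactPart_pos_of_base hε hl]
      ext v
      simp [extDeriv, ContinuousAlternatingMap.alternatizeUncurryFin_apply]
    rw [h1]
    ext v
    rw [contactPart_apply]
    exact Finset.sum_eq_zero fun _ _ => rfl
  · simp

variable {W : TopologicalSpace.Opens (FibCoord (n + 1) m)}

theorem differentiableAt_contactPart {R : LocForm (n + 1) m k q}
    (hR : ContDiffOn ℝ ∞ R (jetsOver k (W : Set (FibCoord (n + 1) m)))) (p : ℕ) (u : InfOver W) :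
    DifferentiableAt ℝ (contactPart p R) (trunc (k + 1) u.1) :=
  ((contDiffOn_contactPart hR p).contDiffAt
    ((isOpen_jetsOver (k + 1)).mem_nhds (trunc_mem (k + 1) u))).differentiableAt (by simp)

/-- Contraction with `Jψ` uses up the only contact slot of `p_1 R`, so the current is horizontal and
`d_H` is the horizontal part of `d`. Differentiating `p_1 R(Jψ, …)` along `d_i` also differentiates
`Jψ`; by `hasFDerivAt_prolong` this yields exactly the shift terms of
`extDeriv_of_horizontal_eq_zero`, and the two minus signs match. -/
theorem dH_noetherCurrent {R : LocForm (n + 1) m k (n + 1)}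
    (hR : ContDiffOn ℝ ∞ R (jetsOver k (W : Set (FibCoord (n + 1) m))))
    {ψ : FibCoord (n + 1) m → Fin m → ℝ} {Ψ : Fin m → JetFun W}
    (hψ : ∀ σ, Represents 0 (fibreFun ψ σ) (Ψ σ).1) (u : InfOver W) :
    dH (noetherCurrent ψ R) (trunc (k + 3) u.1) =
      extDeriv (contactPart 1 R) (trunc (k + 1) u.1)
        (Matrix.vecCons (trunc (k + 1) (prolongInf Ψ u))
          (fun i => trunc (k + 1) (totalInf i u.1))) • vol (n + 1) m (k + 3) := by
  obtain ⟨P, hP, hPi⟩ := hasFDerivAt_prolong (k := k + 1) hψ u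
  have hα := differentiableAt_contactPart hR 1 u
  have hε : ∀ v x, noetherCurrent ψ R v x =
      -contactPart 1 R v (Matrix.vecCons (prolong (k + 1) ψ v) x) := fun v x => rfl
  have hder : ∀ x, HasFDerivAt (fun v => noetherCurrent ψ R v x) _ (trunc (k + 1) u.1) :=
    fun x => (hasFDerivAt_vecCons hα hP x).neg
  have hd : DifferentiableAt ℝ (noetherCurrent ψ R) (trunc (k + 1) u.1) :=
    differentiableAt_alternating fun x => (hder x).differentiableAt
  rw [dH_of_base (k := k + 1) ?_ u hd]
  · congr 1
    rw [extDeriv_of_horizontal_eq_zero u hα (fun v => contactPart_one_totalVec R v id)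
      (fun i => rfl), extDeriv_apply hd, ← Finset.sum_neg_distrib]
    refine Finset.sum_congr rfl fun i _ => ?_
    rw [(hder _).fderiv, prolong_trunc hψ]
    simp only [neg_apply, add_apply, ContinuousLinearMap.comp_apply, hPi]
    have h1 : (contactPart 1 R (trunc (k + 1) u.1)).toContinuousLinearMap
        (Matrix.vecCons (trunc (k + 1) (prolongInf Ψ u))
          (i.removeNth fun i => trunc (k + 1) (totalInf i u.1))) 0
        (trunc (k + 1) (shiftInf i (prolongInf Ψ u))) =
      contactPart 1 R (trunc (k + 1) u.1)
        (Matrix.vecCons (trunc (k + 1) (shiftInf i (prolongInf Ψ u)))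
          (i.removeNth fun i => trunc (k + 1) (totalInf i u.1))) := by
      change contactPart 1 R (trunc (k + 1) u.1) (Function.update _ 0 _) = _
      congr 1
      funext j
      refine Fin.cases ?_ (fun j => ?_) j <;> simp
    rw [h1]
    ring
  · intro v x y hxy
    rw [hε, hε, contactPart_one_vecCons _ _ rfl, contactPart_one_vecCons _ _ rfl]
    simp only [hor_congr v (hxy _)]

end HorizontalDifferential

/-! ### Residual forms -/

section Residual

variable {n m k : ℕ} {W : TopologicalSpace.Opens (FibCoord n m)}

theorem pull_contactPart_one_apply {N : ℕ} (hN : k + 1 ≤ N) (ξ : LocForm n m k (n + 1))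
    (u : InfJet n m) (v : Fin (n + 1) → JetCoord n m N) :
    pull N (contactPart 1 ξ) (trunc N u) v = ∑ a : Fin (n + 1), (-1) ^ (a : ℕ) *
      (ξ (trunc k u) (Matrix.vecCons (trunc k (conInf u (extend (v a))))
        (fun i => trunc k (totalInf i u))) * vol n m N (a.removeNth v)) := by
  have h1 : pull N (contactPart 1 ξ) (trunc N u) v =
      contactPart 1 ξ (jetProj n m N (k + 1) (trunc N u))
        (fun a => jetProj n m N (k + 1) (v a)) := rfl
  rw [h1, jetProj_trunc hN, contactPart_one_top]
  refine Finset.sum_congr rfl fun a _ => ?_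
  rw [jetProj_trunc (Nat.le_succ k), ← trunc_extend_of_le hN, con_trunc]
  congr 2

theorem pull_contactPart_one_vecCons {N : ℕ} (hN : k + 1 ≤ N) (ξ : LocForm n m k (n + 1))
    (u : InfJet n m) {w : InfJet n m} (hw : w.1 = 0) :
    pull N (contactPart 1 ξ) (trunc N u)
        (Matrix.vecCons (trunc N w) (fun i => trunc N (totalInf i u))) =
      ξ (trunc k u) (Matrix.vecCons (trunc k w) (fun i => trunc k (totalInf i u))) := by
  have h1 : pull N (contactPart 1 ξ) (trunc N u)
      (Matrix.vecCons (trunc N w) (fun i => trunc N (totalInf i u))) =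
      contactPart 1 ξ (jetProj n m N (k + 1) (trunc N u))
        (jetProj n m N (k + 1) ∘
          Matrix.vecCons (trunc N w) (fun i => trunc N (totalInf i u))) := rfl
  have h2 : jetProj n m N (k + 1) ∘
      Matrix.vecCons (trunc N w) (fun i => trunc N (totalInf i u)) =
      Matrix.vecCons (trunc (k + 1) w) (fun i => trunc (k + 1) (totalInf i u)) := by
    funext j
    refine Fin.cases ?_ (fun j => ?_) j <;> simp [jetProj_trunc hN]
  rw [h1, h2, jetProj_trunc hN, contactPart_one_vecCons _ _ hw, jetProj_trunc (Nat.le_succ k),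
    jetProj_trunc (Nat.le_succ k)]
  have h3 : ∀ j, hor (trunc (k + 1) u) (trunc (k + 1) (totalInf j u)) = trunc k (totalInf j u) :=
    fun j => hor_frame _ rfl
  simp only [h3]

variable {L : LocForm n m k n} {F : JetFun W}

theorem RepresentsTop.pull_interiorEuler_apply (h : RepresentsTop L F) {N : ℕ}
    (hN : 2 * k + 1 ≤ N) (u : InfOver W) (v : Fin (n + 1) → JetCoord n m N) :
    pull N (interiorEuler (extDeriv L)) (trunc N u.1) v = ∑ a : Fin (n + 1), (-1) ^ (a : ℕ) *
      ((∑ σ, ((jetAlgebra W).euler σ F).1 u * (conInf u.1 (extend (v a))).2 (0, σ)) *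
        vol n m N (a.removeNth v)) := by
  have h1 : pull N (interiorEuler (extDeriv L)) (trunc N u.1) v =
      interiorEuler (extDeriv L) (jetProj n m N (2 * k + 1) (trunc N u.1))
        (fun a => jetProj n m N (2 * k + 1) (v a)) := rfl
  rw [h1, jetProj_trunc hN, h.interiorEuler_eq, ContinuousAlternatingMap.sum_apply]
  simp only [wedge_apply]
  rw [Finset.sum_comm]
  refine Finset.sum_congr rfl fun a _ => ?_
  rw [← Finset.mul_sum, Finset.sum_mul]
  congr 1
  refine Finset.sum_congr rfl fun σ _ => ?_
  have h2 : vol n m (2 * k + 1) (a.removeNth fun a => jetProj n m N (2 * k + 1) (v a)) =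
      vol n m N (a.removeNth v) := vol_congr fun _ => rfl
  rw [ContinuousAlternatingMap.smul_apply, h2, ← trunc_extend_of_le hN, contactForm_trunc,
    smul_eq_mul]
  change (conInf u.1 (extend (v a))).2 (0, σ) * _ = _
  ring

theorem RepresentsTop.pull_interiorEuler_vecCons (h : RepresentsTop L F) {N : ℕ}
    (hN : 2 * k + 1 ≤ N) (u : InfOver W) {w : InfJet n m} (hw : w.1 = 0) :
    pull N (interiorEuler (extDeriv L)) (trunc N u.1)
        (Matrix.vecCons (trunc N w) (fun i => trunc N (totalInf i u.1))) =
      ∑ σ, ((jetAlgebra W).euler σ F).1 u * w.2 (0, σ) := by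
  have h1 : pull N (interiorEuler (extDeriv L)) (trunc N u.1)
      (Matrix.vecCons (trunc N w) (fun i => trunc N (totalInf i u.1))) =
      interiorEuler (extDeriv L) (jetProj n m N (2 * k + 1) (trunc N u.1))
        (jetProj n m N (2 * k + 1) ∘
          Matrix.vecCons (trunc N w) (fun i => trunc N (totalInf i u.1))) := rfl
  have h2 : jetProj n m N (2 * k + 1) ∘
      Matrix.vecCons (trunc N w) (fun i => trunc N (totalInf i u.1)) =
      Matrix.vecCons (trunc (2 * k + 1) w) (fun i => trunc (2 * k + 1) (totalInf i u.1)) := by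
    funext j
    refine Fin.cases ?_ (fun j => ?_) j <;> simp [jetProj_trunc hN]
  rw [h1, h2, jetProj_trunc hN, h.interiorEuler_eq, ContinuousAlternatingMap.sum_apply]
  refine Finset.sum_congr rfl fun σ _ => ?_
  rw [wedge_vecCons_of_vertical _ _ hw, vol_frame (fun i => rfl), mul_one, contactForm_trunc,
    conInf_of_vertical _ hw, mul_comm]
  rfl

/-- In contrast with `contraction_lieTotal`, `w` is constant: its components are not total
derivatives of each other, which leaves the shift term. -/
theorem verticalPairing_lieTotal (w : InfJet n m) (i : Fin n) (μ : Idx n m →₀ JetFun W) :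
    verticalPairing W w (lieTotal (totalDer i) i μ) =
      totalDer i (verticalPairing W w μ) + verticalPairing W (shiftInf i w) μ := by
  induction μ using Finsupp.induction_linear with
  | zero => simp
  | add f g hf hg => simp only [map_add, hf, hg]; abel
  | single p a =>
    rw [lieTotal_single, map_add]
    simp only [verticalPairing, Finsupp.linearCombination_single, smul_eq_mul, Derivation.leibniz,
      Derivation.map_algebraMap, mul_zero, zero_add]
    rw [mul_comm (totalDer i a)]
    rfl

theorem diffAt_eq_of_integration_by_parts (F : JetFun W) {β : Fin n → Idx n m →₀ JetFun W}
    (hβ : (jetAlgebra W).dv F =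
      ∑ σ, Finsupp.single (0, σ) ((jetAlgebra W).euler σ F) +
        ∑ i, lieTotal (totalDer i) i (β i)) (u : InfOver W) {w : InfJet n m} (hw : w.1 = 0) :
    diffAt F u w = ∑ σ, ((jetAlgebra W).euler σ F).1 u * w.2 (0, σ) +
      ∑ i, ((totalDer i (verticalPairing W w (β i))).1 u +
        (verticalPairing W (shiftInf i w) (β i)).1 u) := by
  rw [diffAt_eq_verticalPairing _ _ hw, hβ, map_add, map_sum, map_sum]
  have h1 : ∀ G H : JetFun W, (G + H).1 u = G.1 u + H.1 u := fun _ _ => rfl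
  simp only [verticalPairing_lieTotal, h1, coe_sum_apply, verticalPairing_single]

/-- The value on `k`-jets of a function of finite order at most `k`. -/
def coeffFun (k : ℕ) (F : JetFun W) (u : JetCoord n m k) : ℝ :=
  reprFun F (jetProj n m k (reprOrder F) u)

theorem represents_coeffFun {F : JetFun W} (h : reprOrder F ≤ k) :
    Represents k (coeffFun k F) F.1 :=
  (represents_reprFun F).pull_back h

/-- Finitely many coefficients occur, so one bound serves both for their orders and for the lengths
of the labels; the residual form thus lives on one finite jet prolongation. -/
theorem exists_order_bound {ι : Type*} [Finite ι] (β : ι → Idx n m →₀ JetFun W) :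
    ∃ T, ∀ i p, reprOrder (β i p) ≤ T ∧ (T < ∑ j, p.1 j → β i p = 0) := by
  have h1 : (⋃ i, (reprOrder '' Set.range (β i)) ∪
      (fun p : Idx n m => ∑ j, p.1 j) '' ((β i).support : Set (Idx n m))).Finite :=
    Set.finite_iUnion fun i =>
      ((β i).finite_range.image _).union ((β i).support.finite_toSet.image _)
  obtain ⟨T, hT⟩ := h1.bddAbove
  refine ⟨T, fun i p => ⟨hT ?_, fun h => ?_⟩⟩
  · exact Set.mem_iUnion.2 ⟨i, Or.inl ⟨_, ⟨p, rfl⟩, rfl⟩⟩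
  · by_contra h2
    exact absurd (hT (Set.mem_iUnion.2 ⟨i, Or.inr ⟨p, by simpa using h2, rfl⟩⟩)) (not_le.2 h)

/-- The contact form with coefficients `μ`. -/
def contactCombination (k : ℕ) (μ : Idx n m →₀ JetFun W) (u : JetCoord n m (k + 1)) :
    JetCoord n m (k + 1) →L[ℝ] ℝ :=
  ∑ I : MultiIndex n k, ∑ σ, coeffFun (k + 1) (μ (I.1, σ)) u • contactForm I σ u

theorem contactCombination_apply (μ : Idx n m →₀ JetFun W) (u v : JetCoord n m (k + 1)) :
    contactCombination k μ u v =
      ∑ I : MultiIndex n k, ∑ σ, coeffFun (k + 1) (μ (I.1, σ)) u * contactForm I σ u v := by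
  simp [contactCombination]

theorem contactCombination_trunc {μ : Idx n m →₀ JetFun W}
    (hμ : ∀ p, reprOrder (μ p) ≤ k ∧ (k < ∑ j, p.1 j → μ p = 0)) (u : InfOver W)
    (v : InfJet n m) :
    contactCombination k μ (trunc (k + 1) u.1) (trunc (k + 1) v) =
      (verticalPairing W (conInf u.1 v) μ).1 u := by
  rw [contactCombination_apply, verticalPairing_eq_sum _ μ (fun p => (hμ p).2)]
  refine Finset.sum_congr rfl fun I _ => Finset.sum_congr rfl fun σ _ => ?_
  rw [contactForm_trunc, (represents_coeffFun ((hμ _).1.trans (Nat.le_succ k))).eq]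

theorem contactCombination_totalVec (μ : Idx n m →₀ JetFun W) (v : JetCoord n m (k + 2))
    (i : Fin n) :
    contactCombination k μ (jetProj n m (k + 2) (k + 1) v) (totalVec i v) = 0 := by
  rw [contactCombination_apply]
  refine Finset.sum_eq_zero fun I _ => Finset.sum_eq_zero fun σ _ => ?_
  have h2 : totalVec i v = trunc (k + 1) (totalInf i (extend v)) := by
    rw [trunc_totalInf]
    exact congrArg _ (trunc_extend v).symm
  rw [h2, ← trunc_extend_of_le (Nat.le_succ (k + 1)), contactForm_trunc, conInf_totalInf]
  exact mul_zero _

theorem contDiffOn_contactCombination {μ : Idx n m →₀ JetFun W}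
    (hμ : ∀ p, reprOrder (μ p) ≤ k) (v : JetCoord n m (k + 1)) :
    ContDiffOn ℝ ∞ (fun u => contactCombination k μ u v)
      (jetsOver (k + 1) (W : Set (FibCoord n m))) := by
  simp only [contactCombination_apply]
  refine ContDiffOn.sum fun I _ => ContDiffOn.sum fun σ _ => ContDiffOn.mul ?_ ?_
  · exact (represents_coeffFun ((hμ _).trans (Nat.le_succ k))).smooth
  · have h1 : ContDiff ℝ ∞ fun u : JetCoord n m (k + 1) => con u v :=
      contDiff_con.clm_apply contDiff_const
    exact (((ContinuousLinearMap.proj (R := ℝ) (φ := fun _ : Fin m => ℝ) σ).comp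
      ((ContinuousLinearMap.proj (R := ℝ) (φ := fun _ : MultiIndex n k => Fin m → ℝ) I).comp
        (ContinuousLinearMap.snd ℝ _ _))).contDiff.comp h1).contDiffOn

end Residual

/-! ### Construction of a residual form and the first variation formula. -/

section ResidualForm

variable {n m k : ℕ} {W : TopologicalSpace.Opens (FibCoord (n + 1) m)}

/-- The form `-∑ β_i ∧ ω_i`, where `ω_i` is the contraction of the volume form with `∂/∂x^i`. -/
def residualForm (k : ℕ) (β : Fin (n + 1) → Idx (n + 1) m →₀ JetFun W) :
    LocForm (n + 1) m (k + 1) (n + 1) := fun u =>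
  -∑ i, wedge (contactCombination k (β i) u)
    ((vol (n + 1) m (k + 1)).curryLeft (stdFrame (n + 1) m (k + 1) i))

theorem residualForm_apply (β : Fin (n + 1) → Idx (n + 1) m →₀ JetFun W)
    (u : JetCoord (n + 1) m (k + 1)) (v : Fin (n + 1) → JetCoord (n + 1) m (k + 1)) :
    residualForm k β u v = -∑ i, ∑ a : Fin (n + 1), (-1) ^ (a : ℕ) *
      (contactCombination k (β i) u (v a) *
        vol (n + 1) m (k + 1) (Matrix.vecCons (stdFrame (n + 1) m (k + 1) i) (a.removeNth v))) := by
  rw [residualForm, ContinuousAlternatingMap.neg_apply, ContinuousAlternatingMap.sum_apply]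
  simp only [wedge_apply]
  rfl

theorem vol_vecCons_removeNth (i j : Fin (n + 1)) {x : Fin n → JetCoord (n + 1) m k}
    (hx : ∀ a, (x a).1 = Pi.single (i.succAbove a) 1) :
    vol (n + 1) m k (Matrix.vecCons (stdFrame (n + 1) m k j) x) =
      if j = i then (-1) ^ (i : ℕ) else 0 := by
  have h1 : vol (n + 1) m k (Matrix.vecCons (stdFrame (n + 1) m k j) x) =
      vol (n + 1) m k (Matrix.vecCons (stdFrame (n + 1) m k j)
        (i.removeNth (stdFrame (n + 1) m k))) := by
    refine vol_congr fun a => ?_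
    refine Fin.cases rfl (fun a => ?_) a
    exact hx a
  have h2 := alternating_update (vol (n + 1) m k) (stdFrame (n + 1) m k) i
    (stdFrame (n + 1) m k j)
  have h3 : ((-1 : ℝ) ^ (i : ℕ)) * (-1) ^ (i : ℕ) = 1 := by
    rw [← mul_pow]; simp
  have h4 : vol (n + 1) m k (Function.update (stdFrame (n + 1) m k) i (stdFrame (n + 1) m k j)) =
      if j = i then 1 else 0 := by
    split_ifs with h
    · subst h
      rw [Function.update_eq_self]
      exact vol_frame fun _ => rfl
    · exact (vol (n + 1) m k).toAlternatingMap.map_eq_zero_of_eq _ (i := i) (j := j)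
        (by simp [h]) (Ne.symm h)
  rw [h4] at h2
  rw [h1]
  have h5 := congrArg (fun c => (-1 : ℝ) ^ (i : ℕ) * c) h2
  simp only [← mul_assoc, h3, one_mul] at h5
  rw [← h5]
  simp

variable {β : Fin (n + 1) → Idx (n + 1) m →₀ JetFun W}

theorem contDiffOn_residualForm (hβ : ∀ i p, reprOrder (β i p) ≤ k) :
    ContDiffOn ℝ ∞ (residualForm k β) (jetsOver (k + 1) (W : Set (FibCoord (n + 1) m))) := by
  refine contDiffOn_alternating fun v => ?_
  simp only [residualForm_apply]
  refine ContDiffOn.neg (ContDiffOn.sum fun i _ => ContDiffOn.sum fun a _ => ?_)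
  exact contDiffOn_const.mul ((contDiffOn_contactCombination (hβ i) _).mul contDiffOn_const)

theorem contactPart_zero_residualForm (u : JetCoord (n + 1) m (k + 2)) :
    contactPart 0 (residualForm k β) u = 0 := by
  rw [contactPart_zero_top, residualForm_apply]
  simp only [contactCombination_totalVec, zero_mul, mul_zero, Finset.sum_const_zero, neg_zero,
    zero_smul]

theorem contactPart_one_residualForm
    (hβ : ∀ i p, reprOrder (β i p) ≤ k ∧ (k < ∑ j, p.1 j → β i p = 0)) (u : InfOver W)
    {w : InfJet (n + 1) m} (hw : w.1 = 0) (i : Fin (n + 1))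
    {x : Fin n → JetCoord (n + 1) m (k + 2)}
    (hx : ∀ a, (x a).1 = Pi.single (i.succAbove a) 1) :
    contactPart 1 (residualForm k β) (trunc (k + 2) u.1) (Matrix.vecCons (trunc (k + 2) w) x) =
      -((-1) ^ (i : ℕ) * (verticalPairing W w (β i)).1 u) := by
  rw [contactPart_one_vecCons _ _ hw, jetProj_trunc (Nat.le_succ (k + 1)),
    jetProj_trunc (Nat.le_succ (k + 1)), residualForm_apply, Finset.sum_eq_single i]
  · rw [Fin.sum_univ_succ, Finset.sum_eq_zero, add_zero]
    · rw [Matrix.cons_val_zero, contactCombination_trunc (hβ i), conInf_of_vertical _ hw]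
      have h1 := vol_vecCons_removeNth (m := m) (k := k + 1) i i
        (x := fun j => hor (trunc (k + 1 + 1) u.1) (x j)) (fun a => by rw [hor_fst, hx])
      rw [if_pos rfl] at h1
      have h2 : Fin.removeNth 0 (Matrix.vecCons (trunc (k + 1) w)
          (fun j => hor (trunc (k + 1 + 1) u.1) (x j))) =
          fun j => hor (trunc (k + 1 + 1) u.1) (x j) := rfl
      rw [h2, h1, Fin.val_zero, pow_zero, one_mul, mul_comm]
    · intro a _
      have h1 : vol (n + 1) m (k + 1) (Matrix.vecCons (stdFrame (n + 1) m (k + 1) i)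
          (a.succ.removeNth (Matrix.vecCons (trunc (k + 1) w)
            (fun j => hor (trunc (k + 1 + 1) u.1) (x j))))) = 0 := by
        cases n with
        | zero => exact a.elim0
        | succ n =>
          obtain ⟨j, hj⟩ := Fin.exists_succAbove_eq (Fin.succ_ne_zero a).symm
          refine vol_eq_zero (i := j.succ) ?_
          rw [Matrix.cons_val_succ, Fin.removeNth_apply, hj]
          exact hw
      rw [h1, mul_zero, mul_zero]
  · intro j _ hj
    refine Finset.sum_eq_zero fun a _ => ?_
    refine Fin.cases ?_ (fun a => ?_) a
    · have h1 := vol_vecCons_removeNth (m := m) (k := k + 1) i j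
        (x := fun j => hor (trunc (k + 1 + 1) u.1) (x j)) (fun a => by rw [hor_fst, hx])
      rw [if_neg hj] at h1
      have h2 : Fin.removeNth 0 (Matrix.vecCons (trunc (k + 1) w)
          (fun j => hor (trunc (k + 1 + 1) u.1) (x j))) =
          fun j => hor (trunc (k + 1 + 1) u.1) (x j) := rfl
      rw [h2, h1, mul_zero, mul_zero]
    · have h1 : vol (n + 1) m (k + 1) (Matrix.vecCons (stdFrame (n + 1) m (k + 1) j)
          (a.succ.removeNth (Matrix.vecCons (trunc (k + 1) w)
            (fun j => hor (trunc (k + 1 + 1) u.1) (x j))))) = 0 := by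
        cases n with
        | zero => exact a.elim0
        | succ n =>
          obtain ⟨b, hb⟩ := Fin.exists_succAbove_eq (Fin.succ_ne_zero a).symm
          refine vol_eq_zero (i := b.succ) ?_
          rw [Matrix.cons_val_succ, Fin.removeNth_apply, hb]
          exact hw
      rw [h1, mul_zero, mul_zero]
  · simp

/-- Since `dx^i ∧ β_i ∧ ω_i = -β_i ∧ vol`, the minus sign in `residualForm` makes `p_1 d p_1`
produce the Lie derivatives of the `β_i` along `d_i`, with a plus sign, here paired with the
vertical vector `w`. -/
theorem extDeriv_contactPart_residualForm
    (hβ : ∀ i p, reprOrder (β i p) ≤ k ∧ (k < ∑ j, p.1 j → β i p = 0)) (u : InfOver W)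
    {w : InfJet (n + 1) m} (hw : w.1 = 0) :
    extDeriv (contactPart 1 (residualForm k β)) (trunc (k + 2) u.1)
        (Matrix.vecCons (trunc (k + 2) w) (fun i => trunc (k + 2) (totalInf i u.1))) =
      ∑ i, ((totalDer i (verticalPairing W w (β i))).1 u +
        (verticalPairing W (shiftInf i w) (β i)).1 u) := by
  have hR := contDiffOn_residualForm (W := W) (β := β) fun i p => (hβ i p).1
  have hα := differentiableAt_contactPart hR 1 u
  rw [extDeriv_of_horizontal_eq_zero u hα
    (fun v => contactPart_one_totalVec (residualForm k β) v id) (fun i => rfl),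
    ← Finset.sum_neg_distrib]
  refine Finset.sum_congr rfl fun i _ => ?_
  have hx : ∀ a, (i.removeNth (fun i => trunc (k + 2) (totalInf i u.1)) a).1 =
      Pi.single (i.succAbove a) 1 := fun a => rfl
  have h1 : Represents (k + 2) (fun v => contactPart 1 (residualForm k β) v
      (Matrix.vecCons (trunc (k + 2) w) (i.removeNth fun i => trunc (k + 2) (totalInf i u.1))))
      (((-(-1) ^ (i : ℕ) : ℝ) • verticalPairing W w (β i) : JetFun W)).1 := by
    refine represents_of_eq _ fun u' => ?_
    rw [contactPart_one_residualForm hβ u' hw i hx]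
    change -(-1) ^ (i : ℕ) * (verticalPairing W w (β i)).1 u' = _
    ring
  have h2 := h1.diffAt_eq u (totalInf i u.1)
  rw [diffAt_smul] at h2
  have h3 : ((-1 : ℝ) ^ (i : ℕ)) * (-1) ^ (i : ℕ) = 1 := by
    rw [← mul_pow]; simp
  rw [contactPart_one_residualForm hβ u (w := shiftInf i w) rfl i hx, ← h2, totalDer_apply]
  linear_combination ((verticalPairing W (shiftInf i w) (β i)).1 u +
    diffAt (verticalPairing W w (β i)) u (totalInf i u.1)) * h3

variable {s : ℕ} {L : LocForm (n + 1) m s (n + 1)} {F : JetFun W}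

theorem exists_isResidual (h : RepresentsTop L F) :
    ∃ (t : ℕ) (R : LocForm (n + 1) m t (n + 1)), IsResidual (W : Set (FibCoord (n + 1) m))
      (extDeriv L) R := by
  obtain ⟨β, hβ⟩ := (jetAlgebra W).exists_integration_by_parts ((jetAlgebra W).dv F)
  obtain ⟨k, hk⟩ := exists_order_bound β
  have key : ∀ N, 2 * s + 1 ≤ N → k + 3 ≤ N →
      ∀ u ∈ jetsOver N (W : Set (FibCoord (n + 1) m)), pull N (contactPart 1 (extDeriv L)) u =
        pull N (interiorEuler (extDeriv L)) u +
          pull N (contactPart 1 (extDeriv (contactPart 1 (residualForm k β)))) u := by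
    intro N h1 h2 u hu
    ext v
    -- All three forms are sums over the one argument that enters through its contact component,
    -- with the same volume factors. It suffices to compare coefficients on that vertical vector.
    rw [ContinuousAlternatingMap.add_apply, ← trunc_extendOver u hu,
      pull_contactPart_one_apply (by omega), pull_contactPart_one_apply h2,
      h.pull_interiorEuler_apply h1, ← Finset.sum_add_distrib]
    refine Finset.sum_congr rfl fun a _ => ?_
    rw [h.extDeriv_apply _ rfl (fun i => rfl), extDeriv_contactPart_residualForm hk _ rfl,
      diffAt_eq_of_integration_by_parts F hβ _ rfl]
    ring
  exact ⟨k + 1, residualForm k β, contDiffOn_residualForm fun i p => (hk i p).1,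
    fun u _ => contactPart_zero_residualForm u, key _ (le_max_left _ _) (le_max_right _ _)⟩

/-- First variation formula for an arbitrary residual form. -/
theorem IsResidual.evol_eq (h : RepresentsTop L F) {t : ℕ} {R : LocForm (n + 1) m t (n + 1)}
    (hR : IsResidual (W : Set (FibCoord (n + 1) m)) (extDeriv L) R)
    {ψ : FibCoord (n + 1) m → Fin m → ℝ} {Ψ : Fin m → JetFun W}
    (hψ : ∀ σ, Represents 0 (fibreFun ψ σ) (Ψ σ).1) (u : InfOver W) :
    dH (noetherCurrent ψ R) (trunc (t + 3) u.1) =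
      ((jetAlgebra W).evol Ψ F - ∑ σ, Ψ σ * (jetAlgebra W).euler σ F).1 u •
        vol (n + 1) m (t + 3) := by
  rw [dH_noetherCurrent hR.smooth hψ]
  congr 1
  set N := max (2 * s + 1) (t + 2) with hN
  have h1 : 2 * s + 1 ≤ N := le_max_left _ _
  have h2 : t + 2 ≤ N := le_max_right _ _
  -- The defining equation of a residual form is evaluated on `(Jψ, d_0, …, d_n)`, at an order where
  -- all its terms are defined.
  have h3 := congrArg (fun A => A (Matrix.vecCons (trunc N (prolongInf Ψ u))
    (fun i => trunc N (totalInf i u.1)))) (hR.integration_by_parts (trunc N u.1) (trunc_mem N u))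
  simp only [ContinuousAlternatingMap.add_apply] at h3
  rw [pull_contactPart_one_vecCons (by omega) _ _ rfl, pull_contactPart_one_vecCons h2 _ _ rfl,
    h.pull_interiorEuler_vecCons h1 _ rfl, h.extDeriv_apply _ rfl (fun i => rfl),
    ← evol_eq_diffAt] at h3
  have h4 : ((jetAlgebra W).evol Ψ F - ∑ σ, Ψ σ * (jetAlgebra W).euler σ F).1 u =
      ((jetAlgebra W).evol Ψ F).1 u - (∑ σ, Ψ σ * (jetAlgebra W).euler σ F).1 u := rfl
  have h5 : (∑ σ, Ψ σ * (jetAlgebra W).euler σ F).1 u =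
      ∑ σ, ((jetAlgebra W).euler σ F).1 u * (prolongInf Ψ u).2 (0, σ) := by
    rw [coe_sum_apply]
    refine Finset.sum_congr rfl fun σ _ => ?_
    change (Ψ σ).1 u * _ = _ * ((jetAlgebra W).DI 0 (Ψ σ)).1 u
    rw [VariationalAlgebra.DI_zero, mul_comm]
  rw [h4, h5, h3, add_sub_cancel_left]

end ResidualForm

/-! ### Vertical fields in fibered charts -/

section Charts

variable {n m : ℕ} {X : Type*} [TopologicalSpace X] [ChartedSpace (Fin n → ℝ) X]
  {Y : Type*} [TopologicalSpace Y] [ChartedSpace (FibCoord n m) Y]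
  {π : Y → X}

/-- The chart of `Y` in fibered coordinates as a differentiable local isomorphism. -/
theorem FiberedChart.mdifferentiable [IsManifold 𝓘(ℝ, FibCoord n m) ∞ Y]
    (c : FiberedChart n m π) :
    c.chart.MDifferentiable 𝓘(ℝ, FibCoord n m) 𝓘(ℝ, FibCoord n m) :=
  ⟨(contMDiffOn_of_mem_maximalAtlas c.chart_mem).mdifferentiableOn (by simp),
    (contMDiffOn_symm_of_mem_maximalAtlas c.chart_mem).mdifferentiableOn (by simp)⟩

/-- The coordinate expression of a vector field on `Y`. -/
def chartField (c : FiberedChart n m π)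
    (ψ : (p : Y) → TangentSpace 𝓘(ℝ, FibCoord n m) p) (z : FibCoord n m) : FibCoord n m :=
  VectorField.mpullback 𝓘(ℝ, FibCoord n m) 𝓘(ℝ, FibCoord n m) c.chart.symm ψ z

theorem contMDiffAt_symm (c : FiberedChart n m π) {z : FibCoord n m} (hz : z ∈ c.chart.target) :
    ContMDiffAt 𝓘(ℝ, FibCoord n m) 𝓘(ℝ, FibCoord n m) ∞ c.chart.symm z :=
  (contMDiffOn_symm_of_mem_maximalAtlas c.chart_mem).contMDiffAt
    (c.chart.open_target.mem_nhds hz)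

variable [IsManifold 𝓘(ℝ, FibCoord n m) ∞ Y]

/-- The inverse of the differential of the inverse chart is the differential of the chart. This ties
`fibreComponents` to a pull-back of vector fields, for which smoothness and naturality of the
bracket are available. -/
theorem chartField_eq (c : FiberedChart n m π)
    (ψ : (p : Y) → TangentSpace 𝓘(ℝ, FibCoord n m) p) {z : FibCoord n m}
    (hz : z ∈ c.chart.target) :
    chartField c ψ z = mfderiv 𝓘(ℝ, FibCoord n m) 𝓘(ℝ, FibCoord n m) c.chart (c.chart.symm z)
      (ψ (c.chart.symm z)) := by
  have h1 := c.mdifferentiable.comp_symm_deriv hz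
  have h2 := c.mdifferentiable.symm_comp_deriv (c.chart.map_target hz)
  rw [c.chart.right_inv hz] at h2
  rw [chartField, VectorField.mpullback_apply]
  exact congrArg (fun A => A (ψ (c.chart.symm z))) (ContinuousLinearMap.inverse_eq h2 h1)

theorem fibreComponents_eq (c : FiberedChart n m π)
    (ψ : (p : Y) → TangentSpace 𝓘(ℝ, FibCoord n m) p) {z : FibCoord n m}
    (hz : z ∈ c.chart.target) : fibreComponents c ψ z = (chartField c ψ z).2 := by
  rw [chartField_eq c ψ hz]
  rfl

theorem isInvertible_mfderiv_symm (c : FiberedChart n m π) {z : FibCoord n m}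
    (hz : z ∈ c.chart.target) :
    (mfderiv 𝓘(ℝ, FibCoord n m) 𝓘(ℝ, FibCoord n m) c.chart.symm z).IsInvertible :=
  ⟨c.mdifferentiable.symm.mfderiv hz, rfl⟩

theorem contDiffOn_chartField (c : FiberedChart n m π) (ψ : VerticalField n m π) :
    ContDiffOn ℝ ∞ (chartField c ψ.field) c.chart.target := by
  intro z hz
  refine ContDiffAt.contDiffWithinAt ?_
  have h1 := ContMDiffAt.mpullback_vectorField_preimage (m := ∞) (n := ∞)
    (ψ.smooth (c.chart.symm z)) (contMDiffAt_symm c hz) (isInvertible_mfderiv_symm c hz) (by simp)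
  exact contMDiffAt_vectorSpace_iff_contDiffAt.1 h1

/-- In fibered coordinates the first projection is `π` followed by the base chart, so the
differential sends a vertical vector to one without base component. -/
theorem chartField_fst [IsManifold 𝓘(ℝ, Fin n → ℝ) ∞ X] (hπ : IsFibration n m π)
    (c : FiberedChart n m π) (ψ : VerticalField n m π) {z : FibCoord n m}
    (hz : z ∈ c.chart.target) : (chartField c ψ.field z).1 = 0 := by
  set p := c.chart.symm z with hp
  have hps : p ∈ c.chart.source := c.chart.map_target hz
  have h1 : MDifferentiableAt 𝓘(ℝ, FibCoord n m) 𝓘(ℝ, FibCoord n m) c.chart p :=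
    c.mdifferentiable.mdifferentiableAt hps
  have h2 : MDifferentiableAt 𝓘(ℝ, FibCoord n m) 𝓘(ℝ, Fin n → ℝ) π p :=
    hπ.smooth.mdifferentiableAt (by simp)
  have h3 : MDifferentiableAt 𝓘(ℝ, Fin n → ℝ) 𝓘(ℝ, Fin n → ℝ) c.base (π p) :=
    ((contMDiffOn_of_mem_maximalAtlas c.base_mem).contMDiffAt
      (c.base.open_source.mem_nhds (c.proj_mem p hps))).mdifferentiableAt (by simp)
  have h4 : MDifferentiableAt 𝓘(ℝ, FibCoord n m) 𝓘(ℝ, Fin n → ℝ)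
      (ContinuousLinearMap.fst ℝ (Fin n → ℝ) (Fin m → ℝ)) (c.chart p) :=
    (ContinuousLinearMap.fst ℝ (Fin n → ℝ) (Fin m → ℝ)).mdifferentiableAt
  have h5 : (ContinuousLinearMap.fst ℝ (Fin n → ℝ) (Fin m → ℝ)) ∘ c.chart =ᶠ[nhds p]
      c.base ∘ π := by
    filter_upwards [c.chart.open_source.mem_nhds hps] with q hq
    exact c.fst_eq q hq
  have h6 := h5.mfderiv_eq (I := 𝓘(ℝ, FibCoord n m)) (I' := 𝓘(ℝ, Fin n → ℝ))
  rw [mfderiv_comp p h4 h1, mfderiv_comp p h3 h2, ContinuousLinearMap.mfderiv_eq] at h6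
  rw [chartField_eq c ψ.field hz]
  have h7 := congrArg (fun A => A (ψ.field p)) h6
  refine h7.trans ?_
  change mfderiv 𝓘(ℝ, Fin n → ℝ) 𝓘(ℝ, Fin n → ℝ) c.base (π p)
    (mfderiv 𝓘(ℝ, FibCoord n m) 𝓘(ℝ, Fin n → ℝ) π p (ψ.field p)) = 0
  rw [ψ.vertical p, map_zero]

theorem chartField_bracket (c : FiberedChart n m π) (ψ₁ ψ₂ : VerticalField n m π)
    {z : FibCoord n m} (hz : z ∈ c.chart.target) :
    chartField c (VectorField.mlieBracket 𝓘(ℝ, FibCoord n m) ψ₁.field ψ₂.field) z =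
      VectorField.lieBracket ℝ (chartField c ψ₁.field) (chartField c ψ₂.field) z := by
  have : IsManifold 𝓘(ℝ, FibCoord n m) (minSmoothness ℝ 2) Y := by
    rw [minSmoothness_of_isRCLikeNormedField]
    exact IsManifold.of_le (n := ∞) (by simpa using WithTop.coe_le_coe.2 (le_top : (2 : ℕ∞) ≤ ⊤))
  have h := VectorField.mpullback_mlieBracket (n := ∞)
    ((ψ₁.smooth (c.chart.symm z)).mdifferentiableAt (by simp))
    ((ψ₂.smooth (c.chart.symm z)).mdifferentiableAt (by simp)) (contMDiffAt_symm c hz)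
    (by
      rw [minSmoothness_of_isRCLikeNormedField]
      simpa using WithTop.coe_le_coe.2 (le_top : (2 : ℕ∞) ≤ ⊤))
  refine h.trans ?_
  rw [← VectorField.mlieBracketWithin_univ, VectorField.mlieBracketWithin_eq_lieBracketWithin]
  exact congrFun (VectorField.lieBracketWithin_univ (𝕜 := ℝ) (V := chartField c ψ₁.field)
    (W := chartField c ψ₂.field)) z

/-- The fibre components of the bracket of vertical vector fields. -/
theorem fibreComponents_bracket [IsManifold 𝓘(ℝ, Fin n → ℝ) ∞ X] (hπ : IsFibration n m π)
    (c : FiberedChart n m π) (ψ₁ ψ₂ : VerticalField n m π) {z : FibCoord n m}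
    (hz : z ∈ c.chart.target) :
    fibreComponents c (VectorField.mlieBracket 𝓘(ℝ, FibCoord n m) ψ₁.field ψ₂.field) z =
      fderiv ℝ (fibreComponents c ψ₂.field) z (0, fibreComponents c ψ₁.field z) -
        fderiv ℝ (fibreComponents c ψ₁.field) z (0, fibreComponents c ψ₂.field z) := by
  have hnhds := c.chart.open_target.mem_nhds hz
  have h1 : ∀ ψ : VerticalField n m π, chartField c ψ.field z =
      ((0, fibreComponents c ψ.field z) : FibCoord n m) := fun ψ =>
    Prod.ext (chartField_fst hπ c ψ hz) (fibreComponents_eq c ψ.field hz).symm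
  have h2 : ∀ (ψ : VerticalField n m π) (w : FibCoord n m),
      (fderiv ℝ (chartField c ψ.field) z w).2 = fderiv ℝ (fibreComponents c ψ.field) z w := by
    intro ψ w
    have h3 : fibreComponents c ψ.field =ᶠ[nhds z] fun z => (chartField c ψ.field z).2 := by
      filter_upwards [hnhds] with y hy
      exact fibreComponents_eq c ψ.field hy
    have h4 := ((contDiffOn_chartField c ψ).contDiffAt hnhds).differentiableAt (by simp)
    rw [h3.fderiv_eq, (h4.hasFDerivAt.snd).fderiv]
    rfl
  rw [fibreComponents_eq c _ hz, chartField_bracket c ψ₁ ψ₂ hz, VectorField.lieBracket,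
    Prod.snd_sub, h2, h2, h1, h1]

theorem contDiffOn_fibreComponents (c : FiberedChart n m π) (ψ : VerticalField n m π) :
    ContDiffOn ℝ ∞ (fibreComponents c ψ.field) c.chart.target :=
  ((contDiffOn_chartField c ψ).snd).congr fun _ hz => fibreComponents_eq c ψ.field hz

end Charts

/-! ### The second variation in a fibered chart -/

section SecondVariation

variable {n m k : ℕ} {W : TopologicalSpace.Opens (FibCoord n m)}

/-- A smooth function on `k`-jets as a function on infinite jets. -/
def JetFun.ofContDiffOn {f : JetCoord n m k → ℝ}
    (hf : ContDiffOn ℝ ∞ f (jetsOver k (W : Set (FibCoord n m)))) : JetFun W :=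
  ⟨fun u => f (trunc k u.1), k, f, hf, fun _ => rfl⟩

theorem represents_ofContDiffOn {f : JetCoord n m k → ℝ}
    (hf : ContDiffOn ℝ ∞ f (jetsOver k (W : Set (FibCoord n m)))) :
    Represents k f (JetFun.ofContDiffOn hf).1 := ⟨hf, fun _ => rfl⟩

theorem contDiff_toFib : ContDiff ℝ ∞ (toFib : JetCoord n m k → FibCoord n m) := by
  unfold toFib
  fun_prop

theorem contDiffOn_fibreFun {ψ : FibCoord n m → Fin m → ℝ} (hψ : ContDiffOn ℝ ∞ ψ W) (σ : Fin m) :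
    ContDiffOn ℝ ∞ (fibreFun ψ σ) (jetsOver 0 (W : Set (FibCoord n m))) :=
  (contDiffOn_pi.1 hψ σ).comp contDiff_toFib.contDiffOn fun _ hu => hu

theorem representsTop_horizontalize {ρ : LocForm n m k n}
    (hρ : ContDiffOn ℝ ∞ ρ (jetsOver k (W : Set (FibCoord n m)))) :
    ∃ F : JetFun W, RepresentsTop (horizontalize ρ) F := by
  have h1 : ContDiffOn ℝ ∞ (fun u => horizontalize ρ u (stdFrame n m (k + 1)))
      (jetsOver (k + 1) (W : Set (FibCoord n m))) :=
    contDiffOn_alternating_comp_apply (contDiffOn_contactPart hρ 0)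
      (g := fun _ _ => ContinuousLinearMap.id ℝ _) (fun _ => contDiffOn_const) _
  refine ⟨JetFun.ofContDiffOn h1, fun u => ?_⟩
  change _ = horizontalize ρ (trunc (k + 1) u.1) (stdFrame n m (k + 1)) • vol n m (k + 1)
  rw [horizontalize, contactPart_zero_top, ContinuousAlternatingMap.smul_apply,
    vol_frame fun _ => rfl, smul_eq_mul, mul_one]

theorem Represents.dv_apply {ψ : FibCoord n m → Fin m → ℝ} (hψ : ContDiffOn ℝ ∞ ψ W)
    {Ψ : Fin m → JetFun W} (h : ∀ σ, Represents 0 (fibreFun ψ σ) (Ψ σ).1) (ν σ : Fin m)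
    (u : InfOver W) :
    ((jetAlgebra W).dv (Ψ ν) (0, σ)).1 u =
      fderiv ℝ ψ (toFib (trunc 0 u.1)) (0, Pi.single σ 1) ν := by
  have h1 : ((jetAlgebra W).dv (Ψ ν) (0, σ)).1 u = diffAt (Ψ ν) u (coordInf (0, σ)) := rfl
  have h2 : DifferentiableAt ℝ ψ (toFib (trunc 0 u.1)) :=
    (hψ.contDiffAt (W.isOpen.mem_nhds u.2)).differentiableAt (by simp)
  let T : JetCoord n m 0 →L[ℝ] FibCoord n m :=
    (ContinuousLinearMap.fst ℝ (Fin n → ℝ) (MultiIndex n 0 → Fin m → ℝ)).prod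
      ((ContinuousLinearMap.proj (R := ℝ) (φ := fun _ : MultiIndex n 0 => Fin m → ℝ)
        (MultiIndex.zero n 0)).comp
          (ContinuousLinearMap.snd ℝ (Fin n → ℝ) (MultiIndex n 0 → Fin m → ℝ)))
  have h3 : HasFDerivAt (toFib : JetCoord n m 0 → FibCoord n m) T (trunc 0 u.1) := T.hasFDerivAt
  have h4 := hasFDerivAt_pi'.1 (h2.hasFDerivAt.comp _ h3) ν
  have h5 : HasFDerivAt (fibreFun ψ ν) _ (trunc 0 u.1) := h4
  rw [h1, (h ν).diffAt_eq, h5.fderiv]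
  have h6 : trunc 0 (coordInf ((0 : Fin n → ℕ), σ)) = coordVec (MultiIndex.zero n 0) σ 0 :=
    trunc_coordInf (MultiIndex.zero n 0) σ
  rw [h6]
  simp [T, coordVec]

theorem fderiv_vertical_apply (ψ : FibCoord n m → Fin m → ℝ) (z : FibCoord n m) (x : Fin m → ℝ)
    (ν : Fin m) :
    fderiv ℝ ψ z (0, x) ν = ∑ σ, x σ * fderiv ℝ ψ z (0, Pi.single σ 1) ν := by
  have h1 : ((0, x) : FibCoord n m) = ∑ σ, x σ • ((0, Pi.single σ 1) : FibCoord n m) := by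
    refine Prod.ext ?_ ?_
    · simp [Prod.fst_sum]
    · simp only [Prod.snd_sum, Prod.smul_snd]
      funext τ
      simp [Finset.sum_apply, Pi.single_apply]
  rw [h1, map_sum, Finset.sum_apply]
  exact Finset.sum_congr rfl fun σ _ => by rw [map_smul, Pi.smul_apply, smul_eq_mul]

theorem RepresentsTop.pull_eq {l N : ℕ} {A : LocForm n m l n} {G : JetFun W}
    (h : RepresentsTop A G) (hl : l ≤ N) {u : JetCoord n m N}
    (hu : u ∈ jetsOver N (W : Set (FibCoord n m))) :
    pull N A u = G.1 (extendOver u hu) • vol n m N := by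
  have h1 : ∀ v : InfOver W, pull N A (trunc N v.1) = G.1 v • vol n m N := by
    intro v
    ext x
    rw [pull, jetProj_trunc hl, h v]
    rfl
  have h2 := h1 (extendOver u hu)
  rwa [trunc_extendOver] at h2

end SecondVariation

end FiberedJet

end


/-! ### Assembly of the theorem. -/

open FiberedJet

theorem proposition3p3 (n m r : ℕ)
    {X : Type*} [TopologicalSpace X] [ChartedSpace (Fin (n + 1) → ℝ) X]
    [IsManifold 𝓘(ℝ, Fin (n + 1) → ℝ) ∞ X]
    {Y : Type*} [TopologicalSpace Y] [ChartedSpace (FibCoord (n + 1) m) Y]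
    [IsManifold 𝓘(ℝ, FibCoord (n + 1) m) ∞ Y]
    (π : Y → X) (hπ : IsFibration (n + 1) m π)
    (ρ : JetForm (n + 1) m π r (n + 1)) (ψ₁ ψ₂ : VerticalField (n + 1) m π) (c : FiberedChart (n + 1) m π)
    -- the Lagrangian, the components of the vector fields and of their bracket in the chart
    (L : LocForm (n + 1) m (r + 1) (n + 1)) (hL : L = horizontalize (ρ.repr c))
    (v₁ v₂ v₁₂ : FibCoord (n + 1) m → Fin m → ℝ)
    (hv₁ : v₁ = fibreComponents c ψ₁.field) (hv₂ : v₂ = fibreComponents c ψ₂.field)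
    (hv₁₂ : v₁₂ = fibreComponents c
      (VectorField.mlieBracket 𝓘(ℝ, FibCoord (n + 1) m) ψ₁.field ψ₂.field)) :
    -- the Noether currents of the deformed Lagrangian exist in the chart
    (∃ (t : ℕ) (R : LocForm (n + 1) m t (n + 1)),
      IsResidual c.chart.target (extDeriv (contractEL v₁ L)) R) ∧
    -- and each of them satisfies the identity, up to pull-backs
    ∀ (t : ℕ) (R : LocForm (n + 1) m t (n + 1)),
      IsResidual c.chart.target (extDeriv (contractEL v₁ L)) R →
      ∀ N, 2 * (2 * (r + 1) + 1) + 1 ≤ N → t + 3 ≤ N → ∀ u ∈ jetsOver N c.chart.target,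
        pull N (contractEL v₁ (contractEL v₂ L)) u - pull N (contractEL v₂ (contractEL v₁ L)) u =
          pull N (contractEL v₁₂ L) u + pull N (dH (noetherCurrent v₂ R)) u := by
  let W : TopologicalSpace.Opens (FibCoord (n + 1) m) := ⟨c.chart.target, c.chart.open_target⟩
  have hs₁ : ContDiffOn ℝ ∞ v₁ W := hv₁ ▸ contDiffOn_fibreComponents c ψ₁
  have hs₂ : ContDiffOn ℝ ∞ v₂ W := hv₂ ▸ contDiffOn_fibreComponents c ψ₂
  let Ψ₁ : Fin m → JetFun W := fun σ => JetFun.ofContDiffOn (contDiffOn_fibreFun hs₁ σ)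
  let Ψ₂ : Fin m → JetFun W := fun σ => JetFun.ofContDiffOn (contDiffOn_fibreFun hs₂ σ)
  have h₁ : ∀ σ, Represents 0 (fibreFun v₁ σ) (Ψ₁ σ).1 := fun σ => represents_ofContDiffOn _
  have h₂ : ∀ σ, Represents 0 (fibreFun v₂ σ) (Ψ₂ σ).1 := fun σ => represents_ofContDiffOn _
  -- The coordinate components of the bracket, written in the form in which `second_variation`
  -- produces them; `h₁₂` matches them with the geometric bracket.
  let Ψ₁₂ : Fin m → JetFun W := fun ν => ∑ σ, (Ψ₁ σ * (jetAlgebra W).dv (Ψ₂ ν) (0, σ) -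
    Ψ₂ σ * (jetAlgebra W).dv (Ψ₁ ν) (0, σ))
  have h₁₂ : ∀ ν, Represents 0 (fibreFun v₁₂ ν) (Ψ₁₂ ν).1 := fun ν =>
    represents_of_eq _ fun u => by
      have hz : toFib (trunc 0 u.1) ∈ c.chart.target := u.2
      have e1 : ∀ σ, (Ψ₁ σ * (jetAlgebra W).dv (Ψ₂ ν) (0, σ) -
          Ψ₂ σ * (jetAlgebra W).dv (Ψ₁ ν) (0, σ)).1 u =
          v₁ (toFib (trunc 0 u.1)) σ * ((jetAlgebra W).dv (Ψ₂ ν) (0, σ)).1 u -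
            v₂ (toFib (trunc 0 u.1)) σ * ((jetAlgebra W).dv (Ψ₁ ν) (0, σ)).1 u := fun σ => rfl
      rw [coe_sum_apply, fibreFun, hv₁₂, fibreComponents_bracket hπ c ψ₁ ψ₂ hz, ← hv₁, ← hv₂,
        Pi.sub_apply, fderiv_vertical_apply, fderiv_vertical_apply, ← Finset.sum_sub_distrib]
      simp only [e1, Represents.dv_apply hs₁ h₁, Represents.dv_apply hs₂ h₂]
  obtain ⟨F, hF⟩ := representsTop_horizontalize (W := W) (ρ.smooth c)
  rw [← hL] at hF
  refine ⟨exists_isResidual (hF.contractEL h₁), fun t R hR N hN ht u hu => ?_⟩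
  have hord : ∀ {Ψ : Fin m → JetFun W} {v : FibCoord (n + 1) m → Fin m → ℝ},
      (∀ σ, Represents 0 (fibreFun v σ) (Ψ σ).1) →
        ∀ ν (p : Idx (n + 1) m), p.1 ≠ 0 → (jetAlgebra W).dv (Ψ ν) p = 0 := by
    intro Ψ v h ν p hp
    refine (h ν).partialDer_of_lt (Nat.pos_of_ne_zero fun h0 => hp (funext fun i => ?_))
    exact Finset.sum_eq_zero_iff.1 h0 i (Finset.mem_univ i)
  have key : (∑ σ, Ψ₁ σ * (jetAlgebra W).euler σ (∑ ν, Ψ₂ ν * (jetAlgebra W).euler ν F)) =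
      (jetAlgebra W).evol Ψ₂ (∑ σ, Ψ₁ σ * (jetAlgebra W).euler σ F) +
        ∑ ν, Ψ₁₂ ν * (jetAlgebra W).euler ν F :=
    (jetAlgebra W).second_variation Ψ₁ Ψ₂ (hord h₁) (hord h₂) F
  -- First variation along `ψ₂` of the deformed Lagrangian `ψ₁·E`: the coefficient is `Jψ₂(ψ₁·E) -
  -- ψ₂·E(ψ₁·E)`.
  have hdH : RepresentsTop (dH (noetherCurrent v₂ R)) _ :=
    fun u => IsResidual.evol_eq (hF.contractEL h₁) hR h₂ u
  -- All four terms are multiples of the volume form. After `key`, both sides contain `Jψ₂(ψ₁·E)`,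
  -- the bracket term and `-ψ₂·E(ψ₁·E)`.
  rw [((hF.contractEL h₂).contractEL h₁).pull_eq (by omega) hu,
    ((hF.contractEL h₁).contractEL h₂).pull_eq (by omega) hu,
    (hF.contractEL h₁₂).pull_eq (by omega) hu, hdH.pull_eq (by omega) hu, key]
  have e2 : ∀ G H : JetFun W, ∀ x, (G + H).1 x = G.1 x + H.1 x := fun _ _ _ => rfl
  have e3 : ∀ G H : JetFun W, ∀ x, (G - H).1 x = G.1 x - H.1 x := fun _ _ _ => rfl
  rw [e2, e3]
  ext x
  simp only [ContinuousAlternatingMap.sub_apply, ContinuousAlternatingMap.add_apply,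
    ContinuousAlternatingMap.smul_apply, smul_eq_mul]
  ring
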